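/- Let $C^\infty([0,1],\mathbb R)$ carry its usual Fréchet topology (uniform convergence on $[0,1]$ of the derivatives of every order), and let $\langle f,g\rangle=\int_0^1 f\,\overline g\,dx$ be the scalar product of $L^2((0,1),\mathbb C)$. Let $V\in C^\infty([0,1],\mathbb R)$. Consider the operator $-\frac{d^2}{dx^2}+V$ in $L^2((0,1),\mathbb C)$ with domain $H^2(0,1)\cap H^1_0(0,1)$. Then its eigenvalues form an increasing sequence $\lambda_{1,V}<\lambda_{2,V}<\cdots$, and for every choice of corresponding eigenfunctions $e_{j,V}$, $j\ge1$, normalized in $L^2$, the set of functions $Q\in C^\infty([0,1],\mathbb R)$ such that $$\inf_{p,j\ge 1}\bigl|p^3j^3\langle Qe_{p,V},e_{j,V}\rangle\bigr|>0$$ is dense in $C^\infty([0,1],\mathbb R)$. -/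

import Mathlib

open MeasureTheory Set
open scoped ContDiff ComplexConjugate

noncomputable section

/-- The real vector space of functions `[0,1] → ℝ` that are smooth up to the boundary
(one-sided derivatives at the endpoints; `Set.IccExtend` only provides values outside `[0,1]`,
which `ContDiffOn` on `[0,1]` ignores). -/
def smoothSubmodule : Submodule ℝ (Icc (0 : ℝ) 1 → ℝ) where
  carrier := {f | ContDiffOn ℝ ∞ (IccExtend (zero_le_one' ℝ) f) (Icc 0 1)}
  add_mem' {_ _} hf hg := ContDiffOn.add hf hg
  zero_mem' := contDiffOn_const (c := (0 : ℝ))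
  smul_mem' c _ hf := ContDiffOn.const_smul c hf

/-- The space `C^∞([0,1], ℝ)`. It is a separate type, so that it does not inherit the topology of
pointwise convergence. -/
def SmoothIcc : Type := smoothSubmodule

namespace SmoothIcc

instance : AddCommGroup SmoothIcc := inferInstanceAs (AddCommGroup smoothSubmodule)

instance : Module ℝ SmoothIcc := inferInstanceAs (Module ℝ smoothSubmodule)

/-- The function on `ℝ` that agrees with `f` on `[0,1]` and is constant on either side. -/
def toFun (f : SmoothIcc) : ℝ → ℝ := IccExtend (zero_le_one' ℝ) f.1

instance : CoeFun SmoothIcc fun _ => ℝ → ℝ := ⟨toFun⟩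

theorem contDiffOn (f : SmoothIcc) : ContDiffOn ℝ ∞ f (Icc 0 1) := f.2

/-- The `n`-th derivative, as a linear map from `C^∞([0,1])` to `C([0,1])`. -/
def derivMap (n : ℕ) : SmoothIcc →ₗ[ℝ] C(Icc (0 : ℝ) 1, ℝ) where
  toFun f := ⟨fun x => iteratedDerivWithin n f (Icc 0 1) x,
    (f.contDiffOn.continuousOn_iteratedDerivWithin (by exact_mod_cast le_top)
      (uniqueDiffOn_Icc one_pos)).domRestrict⟩
  map_add' f g := by
    ext x
    exact iteratedDerivWithin_add x.2 (uniqueDiffOn_Icc one_pos)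
      ((f.contDiffOn x x.2).of_le (by exact_mod_cast le_top))
      ((g.contDiffOn x x.2).of_le (by exact_mod_cast le_top))
  map_smul' c f := by
    ext x
    exact iteratedDerivWithin_const_smul x.2 (uniqueDiffOn_Icc one_pos) c
      ((f.contDiffOn x x.2).of_le (by exact_mod_cast le_top))

/-- The seminorms `f ↦ sup_{[0,1]} |f^(n)|`, `n ≥ 0`. -/
def seminorms : SeminormFamily ℝ SmoothIcc ℕ :=
  fun n => (normSeminorm ℝ C(Icc (0 : ℝ) 1, ℝ)).comp (derivMap n)

/-- The usual Fréchet topology of `C^∞([0,1])`: uniform convergence of all derivatives. -/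
instance : TopologicalSpace SmoothIcc := seminorms.moduleFilterBasis.topology

theorem withSeminorms : WithSeminorms seminorms := ⟨rfl⟩

end SmoothIcc

/-- The `L²(0,1)` scalar product of complex-valued functions. -/
def innerL2 (f g : ℝ → ℂ) : ℂ := ∫ x in (0 : ℝ)..1, f x * conj (g x)

/-- `u` belongs to `H²(0,1) ∩ H¹₀(0,1)`, with first and second (weak) derivatives `u₁` and `u₂`:
`u` and `u₁` are the integrals of `u₁` and of `u₂ ∈ L²(0,1)`, and `u` vanishes at `0` and `1`. -/
structure IsDirichletH2 (u u₁ u₂ : ℝ → ℂ) : Prop where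
  memLp : MemLp u₂ 2 (volume.restrict (Icc (0 : ℝ) 1))
  deriv_eq : ∀ x ∈ Icc (0 : ℝ) 1, u₁ x = u₁ 0 + ∫ t in (0 : ℝ)..x, u₂ t
  eq : ∀ x ∈ Icc (0 : ℝ) 1, u x = u 0 + ∫ t in (0 : ℝ)..x, u₁ t
  left : u 0 = 0
  right : u 1 = 0

/-- `u` is an eigenfunction, with `L²` norm one, of the operator `-d²/dx² + V` with domain
`H²(0,1) ∩ H¹₀(0,1)` in `L²((0,1), ℂ)`, for the eigenvalue `lam`. The operator is self-adjoint,
so that its eigenvalues are real. -/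
def IsNormalizedEigenfunction (V : SmoothIcc) (lam : ℝ) (u : ℝ → ℂ) : Prop :=
  innerL2 u u = 1 ∧
  ∃ u₁ u₂ : ℝ → ℂ, IsDirichletH2 u u₁ u₂ ∧
    ∀ᵐ x ∂(volume.restrict (Icc (0 : ℝ) 1)), -u₂ x + (V x : ℂ) * u x = (lam : ℂ) * u x

/-- `lam 1 < lam 2 < ⋯` is the list of all eigenvalues of `-d²/dx² + V` with Dirichlet boundary
conditions (each of them has a one-dimensional eigenspace), and `e j` is a normalized eigenfunction
for `lam j`. -/
structure IsEigensystem (V : SmoothIcc) (lam : ℕ+ → ℝ) (e : ℕ+ → ℝ → ℂ) : Prop where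
  strictMono : StrictMono lam
  eigen : ∀ j, IsNormalizedEigenfunction V (lam j) (e j)
  exhaustive : ∀ (μ : ℝ) (u : ℝ → ℂ), IsNormalizedEigenfunction V μ u → ∃ j, lam j = μ

end

/-! Shift `V` by a constant to get `W ≥ 0` and write the shifted eigenvalues as `w n ^ 2`. In Prüfer
coordinates the eigenvalue condition is that the angle at `1` equals `n π`; monotonicity of the
angle in `w` yields the whole spectrum, its simplicity, and `w n = n π + O(1/n)`, `g n x = sin (n π
x) + O(1/n)` (`exists_isDirichletSystem`). Eigenfunctions are unique up to a scalar, so everything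
reduces to the real integrals `I(p,j) = ∫ Q g_p g_j` (`norm_innerL2`).

Far from the diagonal, integrating by parts against the squared eigenvalue difference
(`integral_mul_solutions`) leaves a boundary term `w p * w j * (± ρ p ρ j Q'(1) - Q'(0))`, and the
remainder is smaller by a factor of order `(w j - w p)⁻²`. If the bracket stays away from `0`, then
for `j - p` large `|I(p,j)|` is at least a constant times `j / j⁴ = j⁻³`, which is where the cubes
come from (`exists_le_offDiagonal`). On each of the finitely many remaining parallels `j = p + m`,
`I(p,j)` tends to half a cosine coefficient of `Q` (`tendsto_integral`); if this limit and all
entries are nonzero, they are bounded below.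

So it suffices that countably many linear functionals do not vanish at `Q`. Each of them vanishes at
`exp (t x)` for only countably many `t`, so one exponential avoids all the kernels, and adding small
multiples of it to any `Q` gives density (`dense_forall_ne_zero`). -/

/-! ### Calculus on `[0,1]` with one-sided derivatives -/

/-- `f'` is the derivative of `f` on `[0,1]`, one-sided at the endpoints. -/
def HasDerivIcc {E : Type*} [NormedAddCommGroup E] [NormedSpace ℝ E] (f f' : ℝ → E) : Prop :=
  ∀ x ∈ Icc (0 : ℝ) 1, HasDerivWithinAt f (f' x) (Icc 0 1) x

namespace HasDerivIcc

section Vector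
variable {E : Type*} [NormedAddCommGroup E] [NormedSpace ℝ E] {f f' : ℝ → E}

theorem continuousOn (h : HasDerivIcc f f') : ContinuousOn f (Icc 0 1) :=
  fun x hx => (h x hx).continuousWithinAt

theorem hasDerivAt (h : HasDerivIcc f f') {x : ℝ} (hx : x ∈ Ioo (0 : ℝ) 1) :
    HasDerivAt f (f' x) x :=
  (h x (Ioo_subset_Icc_self hx)).hasDerivAt (Icc_mem_nhds hx.1 hx.2)

theorem hasDerivWithinAt_Ici (h : HasDerivIcc f f') {x : ℝ} (hx : x ∈ Ico (0 : ℝ) 1) :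
    HasDerivWithinAt f (f' x) (Ici x) x :=
  (h x (Ico_subset_Icc_self hx)).mono_of_mem_nhdsWithin
    (Filter.mem_of_superset (Icc_mem_nhdsGE hx.2) (Icc_subset_Icc_left hx.1))

theorem integral_eq_sub [CompleteSpace E] (h : HasDerivIcc f f') (h' : ContinuousOn f' (Icc 0 1))
    {x : ℝ} (hx : x ∈ Icc (0 : ℝ) 1) : ∫ t in (0 : ℝ)..x, f' t = f x - f 0 := by
  have hs : Icc 0 x ⊆ Icc (0 : ℝ) 1 := Icc_subset_Icc_right hx.2
  refine intervalIntegral.integral_eq_sub_of_hasDerivAt_of_le hx.1 (h.continuousOn.mono hs)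
    (fun t ht => h.hasDerivAt ⟨ht.1, ht.2.trans_le hx.2⟩) ?_
  exact (h'.mono hs).intervalIntegrable_of_Icc hx.1

theorem eqOn_zero {A : ℝ} (h : HasDerivIcc f f') (h0 : f 0 = 0)
    (hb : ∀ x ∈ Icc (0 : ℝ) 1, ‖f' x‖ ≤ A * ‖f x‖) : ∀ x ∈ Icc (0 : ℝ) 1, f x = 0 :=
  eq_zero_of_abs_deriv_le_mul_abs_self_of_eq_zero_right h.continuousOn
    (fun _ hx => h.hasDerivWithinAt_Ici hx) h0 (fun x hx => hb x (Ico_subset_Icc_self hx))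

theorem of_continuousOn [CompleteSpace E] (h' : ContinuousOn f' (Icc 0 1)) :
    HasDerivIcc (fun x => ∫ t in (0 : ℝ)..x, f' t) f' := by
  intro x hx
  have : Fact (x ∈ Icc (0 : ℝ) 1) := ⟨hx⟩
  refine intervalIntegral.integral_hasDerivWithinAt_right (t := Icc 0 1) ?_ ?_ (h' x hx)
  · exact (h'.mono (Icc_subset_Icc_right hx.2)).intervalIntegrable_of_Icc hx.1
  · exact h'.stronglyMeasurableAtFilter_nhdsWithin measurableSet_Icc x

end Vector

variable {f f' : ℝ → ℝ}

theorem monotoneOn (h : HasDerivIcc f f') (h' : ∀ x ∈ Icc (0 : ℝ) 1, 0 ≤ f' x) :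
    MonotoneOn f (Icc 0 1) := by
  refine monotoneOn_of_deriv_nonneg (convex_Icc 0 1) h.continuousOn ?_ ?_
  · intro x hx
    rw [interior_Icc] at hx
    exact (h.hasDerivAt hx).differentiableAt.differentiableWithinAt
  · intro x hx
    rw [interior_Icc] at hx
    rw [(h.hasDerivAt hx).deriv]
    exact h' x (Ioo_subset_Icc_self hx)

theorem strictMonoOn (h : HasDerivIcc f f') (h' : ∀ x ∈ Icc (0 : ℝ) 1, 0 < f' x) :
    StrictMonoOn f (Icc 0 1) := by
  refine strictMonoOn_of_deriv_pos (convex_Icc 0 1) h.continuousOn ?_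
  intro x hx
  rw [interior_Icc] at hx
  rw [(h.hasDerivAt hx).deriv]
  exact h' x (Ioo_subset_Icc_self hx)

/-- The integrating factor `exp (-∫ a)` turns `f` into a function with positive derivative. -/
theorem pos_of_linear {a g : ℝ → ℝ} (h : HasDerivIcc f (fun x => a x * f x + g x)) (h0 : f 0 = 0)
    (ha : ContinuousOn a (Icc 0 1)) (hg : ∀ x ∈ Icc (0 : ℝ) 1, 0 < g x) : 0 < f 1 := by
  set A : ℝ → ℝ := fun x => ∫ t in (0 : ℝ)..x, a t
  have hA : HasDerivIcc A a := of_continuousOn ha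
  have H : HasDerivIcc (fun x => f x * Real.exp (-A x)) (fun x => g x * Real.exp (-A x)) := by
    intro x hx
    refine ((h x hx).mul (hA x hx).neg.exp).congr_deriv ?_
    simp only [Pi.neg_apply]
    ring
  have := H.strictMonoOn (fun x hx => mul_pos (hg x hx) (Real.exp_pos _))
    (left_mem_Icc.2 zero_le_one) (right_mem_Icc.2 zero_le_one) one_pos
  simp only [h0, zero_mul] at this
  exact pos_of_mul_pos_left this (Real.exp_pos _).le

end HasDerivIcc

/-! ### Prüfer angles: existence, bounds, dependence on the spectral parameter -/

/-- Writing the factor with `sinc` keeps it continuous where `x = y`, so that the difference of two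
Prüfer angles solves a linear equation with continuous coefficient. -/
theorem Real.sin_sq_sub_sin_sq (x y : ℝ) :
    Real.sin x ^ 2 - Real.sin y ^ 2 = Real.sinc (x - y) * (x - y) * Real.sin (x + y) := by
  have : Real.sinc (x - y) * (x - y) = Real.sin (x - y) := by
    by_cases h : x - y = 0
    · simp [h]
    · rw [Real.sinc_of_ne_zero h, div_mul_cancel₀ _ h]
  rw [this, Real.sin_sub, Real.sin_add]
  have h1 := Real.sin_sq_add_cos_sq x
  have h2 := Real.sin_sq_add_cos_sq y
  linear_combination (Real.sin y ^ 2) * h1 - (Real.sin x ^ 2) * h2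

theorem Real.abs_sin_sq_sub_sin_sq_le (x y : ℝ) :
    |Real.sin x ^ 2 - Real.sin y ^ 2| ≤ |x - y| := by
  rw [Real.sin_sq_sub_sin_sq, abs_mul, abs_mul]
  have h1 : |Real.sinc (x - y)| ≤ 1 := Real.abs_sinc_le_one _
  have h2 := Real.abs_sin_le_one (x + y)
  calc _ ≤ 1 * |x - y| * 1 := by gcongr
    _ = _ := by ring

/-- `φ` is the Prüfer angle, scaled by `w`, of the solution of `y'' = (W - w²) y`, `y 0 = 0`. -/
structure IsPruferAngle (W : ℝ → ℝ) (w : ℝ) (φ : ℝ → ℝ) : Prop where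
  zero : φ 0 = 0
  deriv : HasDerivIcc φ (fun x => w - W x / w * Real.sin (φ x) ^ 2)

section Prufer
variable {W : ℝ → ℝ} {K : ℝ}

theorem exists_isPruferAngle (hW : ContinuousOn W (Icc 0 1)) {w : ℝ} :
    ∃ φ, IsPruferAngle W w φ := by
  obtain ⟨B, hB⟩ := isCompact_Icc.exists_bound_of_continuousOn (hW.div_const w)
  have hB0 : 0 ≤ B := (norm_nonneg _).trans (hB 0 (left_mem_Icc.2 zero_le_one))
  have hsq : ∀ t : ℝ, |Real.sin t ^ 2| ≤ 1 := fun t => by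
    rw [abs_of_nonneg (sq_nonneg _)]; exact Real.sin_sq_le_one t
  -- The field is bounded by `|w| + B` and `B`-Lipschitz in `θ` for all `θ`, so a ball of radius
  -- `|w| + B` suffices for unit time.
  have key : IsPicardLindelof (fun x θ => w - W x / w * Real.sin θ ^ 2)
      (⟨0, left_mem_Icc.2 zero_le_one⟩ : Icc (0 : ℝ) 1) (0 : ℝ)
      ⟨|w| + B, by positivity⟩ 0 ⟨|w| + B, by positivity⟩ ⟨B, hB0⟩ := by
    refine ⟨?_, ?_, ?_, ?_⟩
    · intro x hx
      refine LipschitzOnWith.of_dist_le_mul fun θ _ θ' _ => ?_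
      rw [Real.dist_eq, Real.dist_eq]
      have : w - W x / w * Real.sin θ ^ 2 - (w - W x / w * Real.sin θ' ^ 2)
          = -((W x / w) * (Real.sin θ ^ 2 - Real.sin θ' ^ 2)) := by ring
      rw [this, abs_neg, abs_mul]
      exact mul_le_mul (hB x hx) (Real.abs_sin_sq_sub_sin_sq_le _ _) (abs_nonneg _) hB0
    · intro θ _
      exact continuousOn_const.sub ((hW.div_const w).mul continuousOn_const)
    · intro x hx θ _
      refine (norm_sub_le _ _).trans (add_le_add le_rfl ?_)
      rw [norm_mul]
      calc _ ≤ B * 1 := mul_le_mul (hB x hx) (hsq θ) (abs_nonneg _) hB0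
        _ = B := mul_one B
    · simp
  obtain ⟨φ, h0, h⟩ := key.exists_eq_forall_mem_Icc_hasDerivWithinAt₀
  exact ⟨φ, h0, h⟩

namespace IsPruferAngle
variable {w w' : ℝ} {φ φ' : ℝ → ℝ}

theorem le (h : IsPruferAngle W w φ) (hw : 0 < w) (hW0 : ∀ x ∈ Icc (0 : ℝ) 1, 0 ≤ W x) {x : ℝ}
    (hx : x ∈ Icc (0 : ℝ) 1) : φ x ≤ w * x := by
  have H : HasDerivIcc (fun x => w * x - φ x) (fun x => W x / w * Real.sin (φ x) ^ 2) := by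
    intro t ht
    refine (((hasDerivWithinAt_id t _).const_mul w).sub (h.deriv t ht)).congr_deriv ?_
    ring
  have := H.monotoneOn (fun t ht => mul_nonneg (div_nonneg (hW0 t ht) hw.le) (sq_nonneg _))
    (left_mem_Icc.2 zero_le_one) hx hx.1
  simp only [h.zero] at this
  linarith

theorem ge (h : IsPruferAngle W w φ) (hw : 0 < w) (hW0 : ∀ x ∈ Icc (0 : ℝ) 1, 0 ≤ W x)
    (hK : ∀ x ∈ Icc (0 : ℝ) 1, W x ≤ K) {x : ℝ}
    (hx : x ∈ Icc (0 : ℝ) 1) : w * x - K / w ≤ φ x := by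
  have H : HasDerivIcc (fun x => φ x - (w - K / w) * x)
      (fun x => K / w - W x / w * Real.sin (φ x) ^ 2) := by
    intro t ht
    refine ((h.deriv t ht).sub ((hasDerivWithinAt_id t _).const_mul (w - K / w))).congr_deriv ?_
    ring
  have hK0 : 0 ≤ K := (hW0 x hx).trans (hK x hx)
  have := H.monotoneOn (fun t ht => ?_) (left_mem_Icc.2 zero_le_one) hx hx.1
  · simp only [h.zero] at this
    have h2 : K / w * x ≤ K / w := mul_le_of_le_one_right (by positivity) hx.2
    linarith
  · rw [sub_nonneg]
    calc _ ≤ W t / w * 1 := by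
          gcongr
          · exact div_nonneg (hW0 t ht) hw.le
          · exact Real.sin_sq_le_one _
      _ ≤ K / w := by rw [mul_one]; gcongr; exact hK t ht

theorem pos (h : IsPruferAngle W w φ) (hw : 0 < w) (hW : ContinuousOn W (Icc 0 1)) : 0 < φ 1 := by
  have hφ := h.deriv.continuousOn
  refine HasDerivIcc.pos_of_linear (f := φ)
    (a := fun x => -(W x / w * (Real.sinc (φ x - 0) * Real.sin (φ x + 0)))) (g := fun _ => w)
    ?_ h.zero ?_ (fun _ _ => hw)
  · intro x hx
    refine (h.deriv x hx).congr_deriv ?_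
    have := Real.sin_sq_sub_sin_sq (φ x) 0
    rw [Real.sin_zero] at this
    linear_combination (-W x / w) * this
  · have := Real.continuous_sinc
    fun_prop

/-- The difference of the angles solves a linear equation whose source is at least `w' - w`; this
uses `W ≥ 0`. -/
theorem strictMono (h : IsPruferAngle W w φ) (h' : IsPruferAngle W w' φ') (hw : 0 < w)
    (hlt : w < w') (hW : ContinuousOn W (Icc 0 1)) (hW0 : ∀ x ∈ Icc (0 : ℝ) 1, 0 ≤ W x) :
    φ 1 < φ' 1 := by
  have hφ := h.deriv.continuousOn
  have hφ' := h'.deriv.continuousOn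
  have := HasDerivIcc.pos_of_linear (f := fun x => φ' x - φ x)
    (a := fun x => -(W x / w * (Real.sinc (φ' x - φ x) * Real.sin (φ' x + φ x))))
    (g := fun x => (w' - w) + W x * (1 / w - 1 / w') * Real.sin (φ' x) ^ 2)
    ?_ (by simp [h.zero, h'.zero]) ?_ ?_
  · linarith
  · intro x hx
    refine ((h'.deriv x hx).sub (h.deriv x hx)).congr_deriv ?_
    have := Real.sin_sq_sub_sin_sq (φ' x) (φ x)
    linear_combination (-W x / w) * this
  · have := Real.continuous_sinc
    fun_prop
  · intro x hx
    have h1 : 1 / w' ≤ 1 / w := one_div_le_one_div_of_le hw hlt.le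
    have : 0 ≤ W x * (1 / w - 1 / w') * Real.sin (φ' x) ^ 2 :=
      mul_nonneg (mul_nonneg (hW0 x hx) (by linarith)) (sq_nonneg _)
    linarith

/-- Grönwall's inequality. It gives continuity in `w`, and for `w' = w` uniqueness of the terminal
angle. -/
theorem abs_sub_le (h : IsPruferAngle W w φ) (h' : IsPruferAngle W w' φ') (hw : 0 < w)
    (hW0 : ∀ x ∈ Icc (0 : ℝ) 1, 0 ≤ W x) (hK : ∀ x ∈ Icc (0 : ℝ) 1, W x ≤ K) :
    |φ' 1 - φ 1| ≤ gronwallBound 0 (K / w) (|w' - w| + K * |1 / w' - 1 / w|) 1 := by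
  have H : HasDerivIcc (fun x => φ' x - φ x) _ := fun x hx => (h'.deriv x hx).sub (h.deriv x hx)
  have := norm_le_gronwallBound_of_norm_deriv_right_le (δ := 0) (K := K / w)
    (ε := |w' - w| + K * |1 / w' - 1 / w|) H.continuousOn
    (fun x hx => H.hasDerivWithinAt_Ici hx) (by simp [h.zero, h'.zero]) ?_ 1
    (right_mem_Icc.2 zero_le_one)
  · simpa using this
  · intro x hx
    have hx := Ico_subset_Icc_self hx
    have hK0 : 0 ≤ K := (hW0 x hx).trans (hK x hx)
    have e : w' - W x / w' * Real.sin (φ' x) ^ 2 - (w - W x / w * Real.sin (φ x) ^ 2)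
      = -(W x / w * (Real.sin (φ' x) ^ 2 - Real.sin (φ x) ^ 2)) +
        ((w' - w) + -(W x * (1 / w' - 1 / w) * Real.sin (φ' x) ^ 2)) := by ring
    rw [e]
    refine (norm_add_le _ _).trans (add_le_add ?_ ((norm_add_le _ _).trans (add_le_add le_rfl ?_)))
    · rw [norm_neg, norm_mul]
      refine mul_le_mul ?_ (Real.abs_sin_sq_sub_sin_sq_le _ _) (norm_nonneg _) (by positivity)
      rw [Real.norm_of_nonneg (div_nonneg (hW0 x hx) hw.le)]
      gcongr
      exact hK x hx
    · rw [norm_neg, norm_mul, norm_mul, Real.norm_of_nonneg (hW0 x hx), Real.norm_eq_abs,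
        Real.norm_of_nonneg (sq_nonneg _)]
      calc _ ≤ W x * |1 / w' - 1 / w| * 1 := by
            gcongr
            · exact mul_nonneg (hW0 x hx) (abs_nonneg _)
            · exact Real.sin_sq_le_one _
        _ ≤ _ := by rw [mul_one]; gcongr; exact hK x hx

end IsPruferAngle

theorem exists_pruferAngle_eq (hW : ContinuousOn W (Icc 0 1))
    (hW0 : ∀ x ∈ Icc (0 : ℝ) 1, 0 ≤ W x) (hK : ∀ x ∈ Icc (0 : ℝ) 1, W x ≤ K) (n : ℕ+) :
    ∃ w φ, 0 < w ∧ IsPruferAngle W w φ ∧ φ 1 = n * Real.pi := by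
  choose φ hφ using fun w => exists_isPruferAngle (W := W) hW (w := w)
  have h1m : (1 : ℝ) ∈ Icc (0 : ℝ) 1 := right_mem_Icc.2 zero_le_one
  have hK0 : 0 ≤ K := (hW0 1 h1m).trans (hK 1 h1m)
  have hn : (1 : ℝ) ≤ n := Nat.one_le_cast.2 n.pos
  have hpi := Real.pi_gt_three
  have hnpi : 3 ≤ n * Real.pi := by nlinarith
  -- At `w = 1` the terminal angle is at most `1`, at `w = b` at least `b - K`; `n π` lies between.
  set b : ℝ := n * Real.pi + K + 1
  have hcont : ContinuousOn (fun w => φ w 1) (Icc 1 b) := by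
    intro w hw
    have hw0 : 0 < w := one_pos.trans_le hw.1
    rw [ContinuousWithinAt, tendsto_iff_dist_tendsto_zero]
    refine squeeze_zero (fun _ => dist_nonneg)
      (fun w' => (hφ w).abs_sub_le (hφ w') hw0 hW0 hK) ?_
    have hc : ContinuousAt (fun w' => gronwallBound 0 (K / w)
        (|w' - w| + K * |1 / w' - 1 / w|) 1) w := by
      refine (gronwallBound_continuous_ε 0 (K / w) 1).continuousAt.comp (f := fun w' =>
        |w' - w| + K * |1 / w' - 1 / w|) ?_
      have : w ≠ 0 := hw0.ne'
      fun_prop (disch := assumption)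
    have := hc.tendsto.mono_left (nhdsWithin_le_nhds (s := Icc 1 b))
    simpa [gronwallBound_ε0_δ0] using this
  have hb1 : 1 ≤ b := by simp only [b]; linarith
  have hlo : φ 1 1 ≤ n * Real.pi := by
    have := (hφ 1).le one_pos hW0 h1m
    linarith
  have hhi : n * Real.pi ≤ φ b 1 := by
    have := (hφ b).ge (one_pos.trans_le hb1) hW0 hK h1m
    have h2 : K / b ≤ K := div_le_self hK0 hb1
    simp only [b] at this h2 ⊢
    linarith
  obtain ⟨w, hw, h⟩ := intermediate_value_Icc hb1 hcont ⟨hlo, hhi⟩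
  exact ⟨w, φ w, one_pos.trans_le hw.1, hφ w, h⟩

end Prufer

/-! ### Uniqueness for the linear equation -/

theorem HasDerivIcc.prodMk {E F : Type*} [NormedAddCommGroup E] [NormedSpace ℝ E]
    [NormedAddCommGroup F] [NormedSpace ℝ F] {f f' : ℝ → E} {g g' : ℝ → F}
    (hf : HasDerivIcc f f') (hg : HasDerivIcc g g') :
    HasDerivIcc (fun x => (f x, g x)) (fun x => (f' x, g' x)) :=
  fun x hx => (hf x hx).prodMk (hg x hx)

/-- Uniqueness for the initial value problem of `u'' = q u`. -/
theorem eqOn_zero_of_hasDerivIcc {q : ℝ → ℝ} (hq : ContinuousOn q (Icc 0 1)) {u u₁ : ℝ → ℂ}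
    (hu : HasDerivIcc u u₁) (hu₁ : HasDerivIcc u₁ (fun x => q x * u x)) (h0 : u 0 = 0)
    (h1 : u₁ 0 = 0) : ∀ x ∈ Icc (0 : ℝ) 1, u x = 0 := by
  obtain ⟨B, hB⟩ := isCompact_Icc.exists_bound_of_continuousOn hq
  have := (hu.prodMk hu₁).eqOn_zero (A := max 1 B) (by simp [h0, h1]) ?_
  · exact fun x hx => congrArg Prod.fst (this x hx)
  · intro x hx
    rw [Prod.norm_def, Prod.norm_def]
    refine max_le ?_ ?_
    · calc ‖u₁ x‖ = 1 * ‖u₁ x‖ := (one_mul _).symm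
        _ ≤ _ := by gcongr <;> simp
    · simp only [norm_mul, Complex.norm_real]
      gcongr
      · exact (hB x hx).trans (le_max_right _ _)
      · simp

/-- With a nonnegative potential there is no Dirichlet solution. -/
theorem eqOn_zero_of_nonneg {q : ℝ → ℝ} (hq : ∀ x ∈ Icc (0 : ℝ) 1, 0 ≤ q x) {u u₁ : ℝ → ℂ}
    (hu : HasDerivIcc u u₁) (hu₁ : HasDerivIcc u₁ (fun x => q x * u x)) (h0 : u 0 = 0)
    (h1 : u 1 = 0) : ∀ x ∈ Icc (0 : ℝ) 1, u x = 0 := by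
  have hre : ∀ {f f' : ℝ → ℂ}, HasDerivIcc f f' → HasDerivIcc (fun x => (f x).re) (fun x => (f' x).re) :=
    fun h x hx => Complex.reCLM.hasFDerivAt.comp_hasDerivWithinAt x (h x hx)
  have him : ∀ {f f' : ℝ → ℂ}, HasDerivIcc f f' → HasDerivIcc (fun x => (f x).im) (fun x => (f' x).im) :=
    fun h x hx => Complex.imCLM.hasFDerivAt.comp_hasDerivWithinAt x (h x hx)
  have m0 : (0 : ℝ) ∈ Icc (0 : ℝ) 1 := left_mem_Icc.2 zero_le_one
  have m1 : (1 : ℝ) ∈ Icc (0 : ℝ) 1 := right_mem_Icc.2 zero_le_one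
  -- The real part of `conj u * u'` is nondecreasing and vanishes at both ends, hence is zero; it is
  -- half the derivative of `|u|²`.
  have hH : HasDerivIcc (fun x => (u x).re * (u₁ x).re + (u x).im * (u₁ x).im)
      (fun x => (u₁ x).re ^ 2 + (u₁ x).im ^ 2 + q x * ((u x).re ^ 2 + (u x).im ^ 2)) := by
    intro x hx
    refine (((hre hu x hx).mul (hre hu₁ x hx)).add
      ((him hu x hx).mul (him hu₁ x hx))).congr_deriv ?_
    simp only [Complex.re_ofReal_mul, Complex.im_ofReal_mul]
    ring
  have hmono := hH.monotoneOn (fun x hx => by have := hq x hx; positivity)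
  have hz : ∀ x ∈ Icc (0 : ℝ) 1, (u x).re * (u₁ x).re + (u x).im * (u₁ x).im = 0 := by
    intro x hx
    have a := hmono m0 hx hx.1
    have b := hmono hx m1 hx.2
    simp only [h0, h1, Complex.zero_re, Complex.zero_im, zero_mul, add_zero] at a b
    exact le_antisymm b a
  have hN : HasDerivIcc (fun x => (u x).re ^ 2 + (u x).im ^ 2) (fun _ => 0) := by
    intro x hx
    refine (((hre hu x hx).pow 2).add ((him hu x hx).pow 2)).congr_deriv ?_
    have := hz x hx
    push_cast
    linear_combination 2 * this
  intro x hx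
  have := hN.integral_eq_sub continuousOn_const hx
  simp only [intervalIntegral.integral_zero, h0, Complex.zero_re, Complex.zero_im] at this
  apply Complex.ext
  · simp only [Complex.zero_re]; nlinarith [sq_nonneg (u x).re, sq_nonneg (u x).im]
  · simp only [Complex.zero_im]; nlinarith [sq_nonneg (u x).re, sq_nonneg (u x).im]

/-! ### Amplitudes and the full Dirichlet spectrum -/

section
variable {W : ℝ → ℝ} {K w : ℝ} {φ : ℝ → ℝ}

/-- The solution of `g'' = (W - w²) g`, `g 0 = 0`, `g' 0 = w`, in polar coordinates. -/
theorem IsPruferAngle.exists_amplitude (h : IsPruferAngle W w φ) (hw : 0 < w)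
    (hW : ContinuousOn W (Icc 0 1)) (hW0 : ∀ x ∈ Icc (0 : ℝ) 1, 0 ≤ W x)
    (hK : ∀ x ∈ Icc (0 : ℝ) 1, W x ≤ K) :
    ∃ r : ℝ → ℝ, r 0 = 1 ∧ (∀ x, 0 < r x) ∧
      (∀ x ∈ Icc (0 : ℝ) 1, |r x - 1| ≤ K / w * Real.exp (K / w)) ∧
      HasDerivIcc (fun x => r x * Real.sin (φ x)) (fun x => w * (r x * Real.cos (φ x))) ∧
      HasDerivIcc (fun x => w * (r x * Real.cos (φ x)))
        (fun x => (W x - w ^ 2) * (r x * Real.sin (φ x))) := by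
  have hφ := h.deriv.continuousOn
  -- The logarithmic derivative of the amplitude, forced by `(r sin φ)' = w r cos φ`.
  set k : ℝ → ℝ := fun x => W x / w * (Real.sin (φ x) * Real.cos (φ x))
  have hk : ContinuousOn k (Icc 0 1) := by fun_prop
  set A : ℝ → ℝ := fun x => ∫ t in (0 : ℝ)..x, k t
  have hA : HasDerivIcc A k := .of_continuousOn hk
  have hr : HasDerivIcc (fun x => Real.exp (A x)) (fun x => Real.exp (A x) * k x) :=
    fun x hx => (hA x hx).exp
  have hAb : ∀ x ∈ Icc (0 : ℝ) 1, |A x| ≤ K / w := by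
    intro x hx
    have hK0 : 0 ≤ K := (hW0 x hx).trans (hK x hx)
    have := intervalIntegral.norm_integral_le_of_norm_le_const (f := k) (a := 0) (b := x)
      (C := K / w) ?_
    · rw [sub_zero, abs_of_nonneg hx.1] at this
      exact this.trans (mul_le_of_le_one_right (by positivity) hx.2)
    · intro t ht
      rw [uIoc_of_le hx.1] at ht
      have ht : t ∈ Icc (0 : ℝ) 1 := ⟨ht.1.le, ht.2.trans hx.2⟩
      have h1 : ‖Real.sin (φ t) * Real.cos (φ t)‖ ≤ 1 := by
        rw [norm_mul]
        exact mul_le_one₀ (Real.abs_sin_le_one _) (norm_nonneg _) (Real.abs_cos_le_one _)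
      have h2 : ‖W t / w‖ ≤ K / w := by
        rw [Real.norm_of_nonneg (div_nonneg (hW0 t ht) hw.le)]
        gcongr
        exact hK t ht
      calc ‖k t‖ = ‖W t / w‖ * ‖Real.sin (φ t) * Real.cos (φ t)‖ := norm_mul _ _
        _ ≤ K / w * 1 := by gcongr
        _ = K / w := mul_one _
  refine ⟨fun x => Real.exp (A x), by simp [A], fun x => Real.exp_pos _, ?_, ?_, ?_⟩
  · intro x hx
    have hb := hAb x hx
    have hK0 : 0 ≤ K / w := (abs_nonneg _).trans hb
    have h1 := Real.add_one_le_exp (A x)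
    have h2 := Real.add_one_le_exp (-A x)
    have h3 : Real.exp (A x) * Real.exp (-A x) = 1 := by rw [← Real.exp_add]; simp
    have h4 : Real.exp (A x) ≤ Real.exp (K / w) := Real.exp_le_exp.2 ((le_abs_self _).trans hb)
    have h5 : 1 ≤ Real.exp (K / w) := Real.one_le_exp hK0
    have h6 := Real.exp_pos (A x)
    obtain ⟨h7, h8⟩ := abs_le.1 hb
    rw [abs_le]
    constructor
    · nlinarith
    · have : Real.exp (A x) - 1 ≤ Real.exp (A x) * A x := by nlinarith
      have : Real.exp (A x) * A x ≤ Real.exp (A x) * (K / w) := by gcongr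
      have : Real.exp (A x) * (K / w) ≤ Real.exp (K / w) * (K / w) := by gcongr
      linarith
  · intro x hx
    refine ((hr x hx).mul (h.deriv x hx).sin).congr_deriv ?_
    simp only [k]
    ring
  · intro x hx
    refine (((hr x hx).mul (h.deriv x hx).cos).const_mul w).congr_deriv ?_
    simp only [k]
    field_simp
    linear_combination (Real.sin (φ x) * W x) * (Real.sin_sq_add_cos_sq (φ x))

/-- The numbers `w n`, in increasing order, are the square roots of the Dirichlet eigenvalues of
`-d²/dx² + W`, and `g n` (with derivative `g₁ n`) is a real eigenfunction, scaled to
`g₁ n 0 = w n`. -/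
structure IsDirichletSystem (W : ℝ → ℝ) (w : ℕ+ → ℝ) (g g₁ : ℕ+ → ℝ → ℝ) (ρ : ℕ+ → ℝ) : Prop where
  strictMono : StrictMono w
  deriv : ∀ n, HasDerivIcc (g n) (g₁ n)
  deriv₂ : ∀ n, HasDerivIcc (g₁ n) (fun x => (W x - w n ^ 2) * g n x)
  left : ∀ n, g n 0 = 0
  right : ∀ n, g n 1 = 0
  deriv_left : ∀ n, g₁ n 0 = w n
  deriv_right : ∀ n, g₁ n 1 = (-1) ^ (n : ℕ) * (w n * ρ n)
  le : ∀ n, n * Real.pi ≤ w n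
  asymp : ∃ C, ∀ n, w n ≤ n * Real.pi + C / n ∧ |ρ n - 1| ≤ C / n ∧
    ∀ x ∈ Icc (0 : ℝ) 1, |g n x - Real.sin (n * Real.pi * x)| ≤ C / n
  exhaustive : ∀ (lam : ℝ) (u u₁ : ℝ → ℂ), HasDerivIcc u u₁ →
    HasDerivIcc u₁ (fun x => ((W x - lam : ℝ) : ℂ) * u x) → u 0 = 0 → u 1 = 0 →
    (∃ x ∈ Icc (0 : ℝ) 1, u x ≠ 0) →
    ∃ n, lam = w n ^ 2 ∧ ∃ c : ℂ, ∀ x ∈ Icc (0 : ℝ) 1, u x = c * g n x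

/-- The terminal angle `n π` selects the `n`-th eigenvalue; `ρ n` is the amplitude at `1`, and the
factor `(-1) ^ n` is `cos (n π)`. -/
theorem exists_isDirichletSystem (hW : ContinuousOn W (Icc 0 1))
    (hW0 : ∀ x ∈ Icc (0 : ℝ) 1, 0 ≤ W x) : ∃ w g g₁ ρ, IsDirichletSystem W w g g₁ ρ := by
  obtain ⟨K, hK⟩ := isCompact_Icc.exists_bound_of_continuousOn hW
  replace hK : ∀ x ∈ Icc (0 : ℝ) 1, W x ≤ K := fun x hx => (le_abs_self _).trans (hK x hx)
  have m0 : (0 : ℝ) ∈ Icc (0 : ℝ) 1 := left_mem_Icc.2 zero_le_one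
  have m1 : (1 : ℝ) ∈ Icc (0 : ℝ) 1 := right_mem_Icc.2 zero_le_one
  have hK0 : 0 ≤ K := (hW0 1 m1).trans (hK 1 m1)
  choose w φ hw hφ hφ1 using exists_pruferAngle_eq hW hW0 hK
  choose r hr0 hrpos hrb hd hd₂ using fun n => (hφ n).exists_amplitude (hw n) hW hW0 hK
  have hle : ∀ n : ℕ+, n * Real.pi ≤ w n := fun n => by
    have := (hφ n).le (hw n) hW0 m1
    rwa [hφ1, mul_one] at this
  have hnw : ∀ n : ℕ+, (n : ℝ) ≤ w n := fun n => by
    refine le_trans ?_ (hle n)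
    exact le_mul_of_one_le_right (Nat.cast_nonneg _) (by linarith [Real.pi_gt_three])
  have hn1 : ∀ n : ℕ+, (1 : ℝ) ≤ n := fun n => Nat.one_le_cast.2 n.pos
  have hKw : ∀ n : ℕ+, K / w n ≤ K / n := fun n =>
    div_le_div_of_nonneg_left hK0 (one_pos.trans_le (hn1 n)) (hnw n)
  have hwle : ∀ n : ℕ+, w n ≤ n * Real.pi + K / w n := fun n => by
    have := (hφ n).ge (hw n) hW0 hK m1
    rw [hφ1, mul_one] at this
    linarith
  have hrb' : ∀ n : ℕ+, ∀ x ∈ Icc (0 : ℝ) 1, |r n x - 1| ≤ K * Real.exp K / n := by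
    intro n x hx
    refine (hrb n x hx).trans ?_
    have h2 : K / w n ≤ K := div_le_self hK0 ((hn1 n).trans (hnw n))
    calc _ ≤ K / n * Real.exp K := by
          gcongr ?_ * ?_
          · exact hKw n
          · exact Real.exp_le_exp.2 h2
      _ = _ := by ring
  refine ⟨w, fun n x => r n x * Real.sin (φ n x), fun n x => w n * (r n x * Real.cos (φ n x)),
    fun n => r n 1, ?_, hd, hd₂, ?_, ?_, ?_, ?_, hle, ⟨K * Real.exp K + 2 * K, ?_⟩, ?_⟩
  · intro n m hnm
    by_contra hc
    have hlt : (n : ℝ) * Real.pi < m * Real.pi := by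
      have : (n : ℝ) < m := by exact_mod_cast hnm
      gcongr
    rcases (not_lt.1 hc).lt_or_eq with h | h
    · have := (hφ m).strictMono (hφ n) (hw m) h hW hW0
      rw [hφ1, hφ1] at this
      linarith
    -- For equal parameters Grönwall's bound is zero, so the terminal angles `n π` and `m π` would
    -- coincide.
    · have h1 := hφ n
      rw [← h] at h1
      have h2 := (hφ m).abs_sub_le h1 (hw m) hW0 hK
      rw [hφ1, hφ1, sub_self, sub_self, abs_zero, mul_zero, add_zero, gronwallBound_ε0_δ0] at h2
      have := abs_nonpos_iff.1 h2
      linarith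
  · intro n; simp [(hφ n).zero]
  · intro n; simp [hφ1]
  · intro n; simp [(hφ n).zero, hr0]
  · intro n
    simp only [hφ1, Real.cos_nat_mul_pi]
    ring
  · intro n
    have hn0 : (0 : ℝ) < n := one_pos.trans_le (hn1 n)
    have e0 : 0 ≤ K * Real.exp K / n := by positivity
    have e1 : 0 ≤ K / n := by positivity
    have e2 : (K * Real.exp K + 2 * K) / n = K * Real.exp K / n + 2 * (K / n) := by ring
    rw [e2]
    refine ⟨?_, ?_, fun x hx => ?_⟩
    · linarith [hwle n, hKw n]
    · linarith [hrb' n 1 m1]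
    · have h1 : r n x * Real.sin (φ n x) - Real.sin (n * Real.pi * x)
          = (r n x - 1) * Real.sin (φ n x)
            + (Real.sin (φ n x) - Real.sin (n * Real.pi * x)) := by ring
      have h2 : |(r n x - 1) * Real.sin (φ n x)| ≤ K * Real.exp K / n := by
        rw [abs_mul]
        calc _ ≤ K * Real.exp K / n * 1 := by
              gcongr
              · exact hrb' n x hx
              · exact Real.abs_sin_le_one _
          _ = _ := mul_one _
      have h3 := Real.abs_sin_sub_sin_le (φ n x) (n * Real.pi * x)
      -- One `K / n` from comparing `φ n x` with `w n * x`, the other from comparing `w n` with `n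
      -- π`.
      have h4 : |φ n x - n * Real.pi * x| ≤ 2 * (K / n) := by
        have a := (hφ n).le (hw n) hW0 hx
        have b := (hφ n).ge (hw n) hW0 hK hx
        have c : 0 ≤ (w n - n * Real.pi) * x := mul_nonneg (by linarith [hle n]) hx.1
        have d : (w n - n * Real.pi) * x ≤ K / w n :=
          (mul_le_of_le_one_right (by linarith [hle n]) hx.2).trans (by linarith [hwle n])
        have e := hKw n
        rw [abs_le]
        constructor <;> linarith
      rw [h1]
      exact (abs_add_le _ _).trans (by linarith)
  · intro lam u u₁ hu hu₁ h0 h1 hne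
    obtain ⟨x₀, hx₀, hx₀u⟩ := hne
    have hlam : 0 < lam := by
      by_contra hc
      refine hx₀u (eqOn_zero_of_nonneg (fun x hx => ?_) hu hu₁ h0 h1 x₀ hx₀)
      linarith [hW0 x hx]
    set s := Real.sqrt lam
    have hs : 0 < s := Real.sqrt_pos.2 hlam
    have hs2 : s ^ 2 = lam := Real.sq_sqrt hlam.le
    obtain ⟨ψ, hψ⟩ := exists_isPruferAngle hW (w := s)
    obtain ⟨R, hR0, hRpos, -, hy, hy₁⟩ := hψ.exists_amplitude hs hW hW0 hK
    have hqc : ContinuousOn (fun x => W x - lam) (Icc 0 1) := hW.sub continuousOn_const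
    -- Every solution vanishing at `0` is a multiple of the one with slope `s`. Applied first to the
    -- Prüfer solution for `s`, to locate `lam`, and at the end to `g n`.
    have prop : ∀ (y y₁ : ℝ → ℝ), HasDerivIcc y y₁ → HasDerivIcc y₁ (fun x => (W x - lam) * y x) →
        y 0 = 0 → y₁ 0 = s → ∀ x ∈ Icc (0 : ℝ) 1, u x = (u₁ 0 / s) * y x := by
      intro y y₁ hy hy₁ hy0 hy₁0 x hx
      refine sub_eq_zero.1 (eqOn_zero_of_hasDerivIcc (u := fun x => u x - (u₁ 0 / s) * y x)
        (u₁ := fun x => u₁ x - (u₁ 0 / s) * y₁ x) hqc (fun x hx => ?_) (fun x hx => ?_) ?_ ?_ x hx)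
      · exact (hu x hx).sub ((hy x hx).ofReal_comp.const_mul _)
      · refine ((hu₁ x hx).sub ((hy₁ x hx).ofReal_comp.const_mul _)).congr_deriv ?_
        push_cast
        ring
      · simp [h0, hy0]
      · simp [hy₁0, hs.ne']
    rw [hs2] at hy₁
    have hprop := prop _ _ hy hy₁ (by simp [hψ.zero]) (by simp [hψ.zero, hR0])
    have hc : u₁ 0 / s ≠ 0 := by
      intro hc
      apply hx₀u
      rw [hprop x₀ hx₀, hc, zero_mul]
    have hsin : Real.sin (ψ 1) = 0 := by
      have := hprop 1 m1
      rw [h1] at this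
      rcases mul_eq_zero.1 this.symm with h | h
      · exact absurd h hc
      · have h := Complex.ofReal_eq_zero.1 h
        exact (mul_eq_zero.1 h).resolve_left (hRpos 1).ne'
    obtain ⟨k, hk⟩ := Real.sin_eq_zero_iff.1 hsin
    have hψpos := hψ.pos hs hW
    have hk0 : 0 < k := by
      rw [← hk] at hψpos
      exact_mod_cast pos_of_mul_pos_left hψpos Real.pi_pos.le
    lift k to ℕ using hk0.le
    obtain ⟨n, rfl⟩ : ∃ n : ℕ+, (n : ℕ) = k := ⟨⟨k, by exact_mod_cast hk0⟩, rfl⟩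
    refine ⟨n, ?_⟩
    -- Both parameters have terminal angle `n π`, and the angle is strictly increasing in the
    -- parameter.
    have hsw : s = w n := by
      have e : φ n 1 = ψ 1 := by rw [hφ1, ← hk]; simp
      rcases lt_trichotomy s (w n) with h | h | h
      · have := hψ.strictMono (hφ _) hs h hW hW0
        linarith
      · exact h
      · have := (hφ _).strictMono hψ (hw _) h hW hW0
        linarith
    refine ⟨by rw [← hsw, hs2], u₁ 0 / s, ?_⟩
    have hd₂' := hd₂ n
    rw [← hsw, hs2] at hd₂'
    have hd' := hd n
    rw [← hsw] at hd'
    exact prop _ _ hd' hd₂' (by simp [(hφ _).zero]) (by simp [(hφ _).zero, hr0])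

end

/-! ### From weak eigenfunctions to the Dirichlet system -/

section
variable {V : SmoothIcc} {c : ℝ} {w : ℕ+ → ℝ} {g g₁ : ℕ+ → ℝ → ℝ} {ρ : ℕ+ → ℝ}

theorem SmoothIcc.continuousOn (V : SmoothIcc) : ContinuousOn V (Icc 0 1) :=
  V.contDiffOn.continuousOn

/-- Regularity: `u₂` is integrable, so `u₁` is continuous and `u` is differentiable; the equation
then replaces `u₂` under the integral by a continuous function. The constant `c` cancels and only
matches the shifted potential. -/
theorem IsNormalizedEigenfunction.hasDerivIcc {μ : ℝ} {u : ℝ → ℂ}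
    (h : IsNormalizedEigenfunction V μ u) (c : ℝ) :
    ∃ u₁, HasDerivIcc u u₁ ∧
      HasDerivIcc u₁ (fun x => ((V x + c - (μ + c) : ℝ) : ℂ) * u x) ∧ u 0 = 0 ∧ u 1 = 0 ∧
      ∃ x ∈ Icc (0 : ℝ) 1, u x ≠ 0 := by
  obtain ⟨hn, u₁, u₂, hD, heq⟩ := h
  have hu₂i : IntegrableOn u₂ (Icc 0 1) := hD.memLp.integrable (by norm_num)
  have hu₁c : ContinuousOn u₁ (Icc 0 1) := by
    have := intervalIntegral.continuousOn_primitive_interval (μ := volume) (a := 0) (b := 1)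
      (f := u₂) (by rwa [uIcc_of_le zero_le_one])
    rw [uIcc_of_le zero_le_one] at this
    exact (continuousOn_const.add this).congr hD.deriv_eq
  have hu : HasDerivIcc u u₁ := fun x hx =>
    ((HasDerivIcc.of_continuousOn hu₁c x hx).const_add (u 0)).congr hD.eq (hD.eq x hx)
  have hqc : ContinuousOn (fun x => ((V x + c - (μ + c) : ℝ) : ℂ) * u x) (Icc 0 1) := by
    refine ContinuousOn.mul ?_ hu.continuousOn
    have := V.continuousOn
    exact Complex.continuous_ofReal.comp_continuousOn (by fun_prop)
  have hint : ∀ x ∈ Icc (0 : ℝ) 1,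
      u₁ x = u₁ 0 + ∫ t in (0 : ℝ)..x, ((V t + c - (μ + c) : ℝ) : ℂ) * u t := by
    intro x hx
    rw [hD.deriv_eq x hx]
    congr 1
    refine intervalIntegral.integral_congr_ae ?_
    rw [ae_restrict_iff' measurableSet_Icc] at heq
    filter_upwards [heq] with t ht htx
    rw [uIoc_of_le hx.1] at htx
    have := ht ⟨htx.1.le, htx.2.trans hx.2⟩
    push_cast
    linear_combination -this
  refine ⟨u₁, hu, fun x hx => ?_, hD.left, hD.right, ?_⟩
  · exact ((HasDerivIcc.of_continuousOn hqc x hx).const_add (u₁ 0)).congr hint (hint x hx)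
  · by_contra! hz
    have : innerL2 u u = 0 := by
      rw [innerL2, intervalIntegral.integral_congr (g := fun _ => 0)]
      · simp
      · intro x hx
        rw [uIcc_of_le zero_le_one] at hx
        simp [hz x hx]
    rw [this] at hn
    exact zero_ne_one hn

namespace IsDirichletSystem

theorem pos (H : IsDirichletSystem W w g g₁ ρ) (n : ℕ+) : 0 < w n :=
  (mul_pos (Nat.cast_pos.2 n.pos) Real.pi_pos).trans_le (H.le n)

/-- The slope at `0` is `w n > 0`. Hence products of eigenfunctions are not identically zero,
without any knowledge of their interior zeros. -/
theorem eventually_pos (H : IsDirichletSystem W w g g₁ ρ) (n : ℕ+) :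
    ∀ᶠ x in nhdsWithin (0 : ℝ) (Ioi 0), 0 < g n x := by
  have h := H.deriv n 0 (left_mem_Icc.2 zero_le_one)
  rw [hasDerivWithinAt_iff_tendsto_slope, H.deriv_left] at h
  have h2 := h.eventually (lt_mem_nhds (H.pos n))
  have h3 : nhdsWithin (0 : ℝ) (Ioo 0 1) ≤ nhdsWithin 0 (Icc 0 1 \ {0}) :=
    nhdsWithin_mono _ fun x hx => ⟨Ioo_subset_Icc_self hx, hx.1.ne'⟩
  rw [nhdsWithin_Ioo_eq_nhdsGT one_pos] at h3
  filter_upwards [h3 h2, self_mem_nhdsWithin] with x hx hx0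
  rw [slope_def_field, H.left, sub_zero, sub_zero] at hx
  have hx0 : 0 < x := hx0
  exact (div_pos_iff_of_pos_right hx0).1 hx

theorem exists_mul_ne_zero (H : IsDirichletSystem W w g g₁ ρ) (n m : ℕ+) :
    ∃ x ∈ Ioo (0 : ℝ) 1, g n x * g m x ≠ 0 := by
  obtain ⟨x, h1, h2, h3⟩ := ((H.eventually_pos n).and
    ((H.eventually_pos m).and (Ioo_mem_nhdsGT one_pos))).exists
  exact ⟨x, h3, (mul_pos h1 h2).ne'⟩

theorem integral_sq_pos (H : IsDirichletSystem W w g g₁ ρ) (n : ℕ+) :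
    0 < ∫ x in (0 : ℝ)..1, g n x ^ 2 := by
  obtain ⟨x, hx, hne⟩ := H.exists_mul_ne_zero n n
  have hc : ContinuousOn (fun x => g n x ^ 2) (Icc 0 1) := (H.deriv n).continuousOn.pow 2
  refine intervalIntegral.integral_pos one_pos hc (fun x _ => sq_nonneg _)
    ⟨x, Ioo_subset_Icc_self hx, ?_⟩
  have : g n x ≠ 0 := left_ne_zero_of_mul hne
  positivity

theorem isNormalizedEigenfunction (H : IsDirichletSystem (fun x => V x + c) w g g₁ ρ) (n : ℕ+) :
    IsNormalizedEigenfunction V (w n ^ 2 - c)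
      (fun x => (((Real.sqrt (∫ x in (0 : ℝ)..1, g n x ^ 2))⁻¹ * g n x : ℝ) : ℂ)) := by
  set N := ∫ x in (0 : ℝ)..1, g n x ^ 2 with hN
  have hNpos : 0 < N := H.integral_sq_pos n
  set a := (Real.sqrt N)⁻¹
  have ha : a ^ 2 * N = 1 := by
    simp only [a, inv_pow, Real.sq_sqrt hNpos.le]
    exact inv_mul_cancel₀ hNpos.ne'
  have h1 : HasDerivIcc (fun x => ((a * g n x : ℝ) : ℂ)) (fun x => ((a * g₁ n x : ℝ) : ℂ)) :=
    fun x hx => ((H.deriv n x hx).const_mul a).ofReal_comp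
  have h2 : HasDerivIcc (fun x => ((a * g₁ n x : ℝ) : ℂ))
      (fun x => ((a * ((V x + c - w n ^ 2) * g n x) : ℝ) : ℂ)) :=
    fun x hx => ((H.deriv₂ n x hx).const_mul a).ofReal_comp
  have h2c : ContinuousOn (fun x => ((a * ((V x + c - w n ^ 2) * g n x) : ℝ) : ℂ)) (Icc 0 1) := by
    have := V.continuousOn
    have := (H.deriv n).continuousOn
    exact Complex.continuous_ofReal.comp_continuousOn (by fun_prop)
  refine ⟨?_, fun x => ((a * g₁ n x : ℝ) : ℂ),
    fun x => ((a * ((V x + c - w n ^ 2) * g n x) : ℝ) : ℂ),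
    ⟨?_, fun x hx => ?_, fun x hx => ?_, ?_, ?_⟩, ?_⟩
  · rw [innerL2]
    have : ∀ x : ℝ, ((a * g n x : ℝ) : ℂ) * conj ((a * g n x : ℝ) : ℂ)
        = ((a ^ 2 * g n x ^ 2 : ℝ) : ℂ) := by
      intro x
      rw [Complex.conj_ofReal]
      push_cast
      ring
    simp only [this]
    rw [intervalIntegral.integral_ofReal, intervalIntegral.integral_const_mul, ← hN, ha]
    simp
  · obtain ⟨B, hB⟩ := isCompact_Icc.exists_bound_of_continuousOn h2c
    exact MemLp.of_bound (h2c.aestronglyMeasurable measurableSet_Icc) B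
      ((ae_restrict_iff' measurableSet_Icc).2 (Filter.Eventually.of_forall hB))
  · rw [h2.integral_eq_sub h2c hx]; ring
  · rw [h1.integral_eq_sub h2.continuousOn hx]; ring
  · simp [H.left]
  · simp [H.right]
  · refine Filter.Eventually.of_forall fun x => ?_
    push_cast
    ring

theorem isEigensystem (H : IsDirichletSystem (fun x => V x + c) w g g₁ ρ) :
    IsEigensystem V (fun n => w n ^ 2 - c)
      (fun n x => (((Real.sqrt (∫ x in (0 : ℝ)..1, g n x ^ 2))⁻¹ * g n x : ℝ) : ℂ)) where
  strictMono n m h := by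
    have := H.pos n
    have := H.strictMono h
    simp only
    gcongr
  eigen n := H.isNormalizedEigenfunction n
  exhaustive μ u hu := by
    obtain ⟨u₁, h1, h2, h3, h4, h5⟩ := hu.hasDerivIcc c
    obtain ⟨n, hn, -⟩ := H.exhaustive _ u u₁ h1 h2 h3 h4 h5
    exact ⟨n, by linarith⟩

theorem eq_const_mul (H : IsDirichletSystem (fun x => V x + c) w g g₁ ρ) {lam : ℕ+ → ℝ}
    {e : ℕ+ → ℝ → ℂ} (he : IsEigensystem V lam e) (n : ℕ+) :
    ∃ a : ℂ, ∀ x ∈ Icc (0 : ℝ) 1, e n x = a * g n x := by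
  have hlam : lam = fun n => w n ^ 2 - c := by
    -- Two strictly increasing enumerations of the same set of eigenvalues coincide.
    refine (he.strictMono.range_inj H.isEigensystem.strictMono).1 (Subset.antisymm ?_ ?_)
    · rintro _ ⟨m, rfl⟩
      exact H.isEigensystem.exhaustive _ _ (he.eigen m)
    · rintro _ ⟨m, rfl⟩
      exact he.exhaustive _ _ (H.isEigensystem.eigen m)
  obtain ⟨u₁, h1, h2, h3, h4, h5⟩ := (he.eigen n).hasDerivIcc c
  obtain ⟨m, hm, a, ha⟩ := H.exhaustive _ _ u₁ h1 h2 h3 h4 h5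
  have hnm : n = m := by
    apply H.strictMono.injective
    rw [hlam, sub_add_cancel] at hm
    exact (pow_left_inj₀ (H.pos n).le (H.pos m).le two_ne_zero).1 hm
  exact ⟨a, hnm ▸ ha⟩

/-- Each `e n` is a scalar multiple of the real `g n`; squaring the modulus removes the phase, and
normalization fixes the modulus of the scalar. -/
theorem norm_innerL2 (H : IsDirichletSystem (fun x => V x + c) w g g₁ ρ) {lam : ℕ+ → ℝ}
    {e : ℕ+ → ℝ → ℂ} (he : IsEigensystem V lam e) (Q : ℝ → ℝ) (p j : ℕ+) :
    ‖innerL2 (fun x => (Q x : ℂ) * e p x) (e j)‖ ^ 2 *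
      ((∫ x in (0 : ℝ)..1, g p x ^ 2) * ∫ x in (0 : ℝ)..1, g j x ^ 2)
      = (∫ x in (0 : ℝ)..1, Q x * (g p x * g j x)) ^ 2 := by
  have key : ∀ (F : ℝ → ℝ) (p j : ℕ+) (a b : ℂ), (∀ x ∈ Icc (0 : ℝ) 1, e p x = a * g p x) →
      (∀ x ∈ Icc (0 : ℝ) 1, e j x = b * g j x) → innerL2 (fun x => (F x : ℂ) * e p x) (e j)
        = a * conj b * (∫ x in (0 : ℝ)..1, F x * (g p x * g j x) : ℝ) := by
    intro F p j a b ha hb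
    rw [innerL2, ← intervalIntegral.integral_ofReal, ← intervalIntegral.integral_const_mul]
    refine intervalIntegral.integral_congr fun x hx => ?_
    rw [uIcc_of_le zero_le_one] at hx
    simp only [ha x hx, hb x hx, map_mul, Complex.conj_ofReal]
    push_cast
    ring
  have hnorm : ∀ (n : ℕ+) (a : ℂ), (∀ x ∈ Icc (0 : ℝ) 1, e n x = a * g n x) →
      ‖a‖ ^ 2 * (∫ x in (0 : ℝ)..1, g n x ^ 2) = 1 := by
    intro n a ha
    have h1 := key (fun _ => 1) n n a a ha ha
    simp only [Complex.ofReal_one, one_mul, (he.eigen n).1, Complex.mul_conj, ← pow_two] at h1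
    rw [Complex.normSq_eq_norm_sq] at h1
    exact_mod_cast h1.symm
  obtain ⟨a, ha⟩ := H.eq_const_mul he p
  obtain ⟨b, hb⟩ := H.eq_const_mul he j
  rw [key Q p j a b ha hb, norm_mul, norm_mul, RCLike.norm_conj, Complex.norm_real,
    Real.norm_eq_abs]
  have h1 := hnorm p a ha
  have h2 := hnorm j b hb
  rw [mul_pow, mul_pow, sq_abs]
  linear_combination ((∫ x in (0 : ℝ)..1, Q x * (g p x * g j x)) ^ 2) *
    (‖b‖ ^ 2 * (∫ x in (0 : ℝ)..1, g j x ^ 2) * h1 + h2)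

end IsDirichletSystem
end

/-! ### The integration by parts identity -/

/-- The derivative on `[0,1]`, one-sided at the endpoints. -/
noncomputable def derivIcc (F : ℝ → ℝ) : ℝ → ℝ := derivWithin F (Icc 0 1)

section
variable {F W : ℝ → ℝ}

theorem ContDiffOn.hasDerivIcc (hF : ContDiffOn ℝ ∞ F (Icc 0 1)) : HasDerivIcc F (derivIcc F) :=
  fun x hx => (hF.differentiableOn (by simp) x hx).hasDerivWithinAt

theorem ContDiffOn.derivIcc (hF : ContDiffOn ℝ ∞ F (Icc 0 1)) :
    ContDiffOn ℝ ∞ (derivIcc F) (Icc 0 1) :=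
  hF.derivWithin (uniqueDiffOn_Icc one_pos) (by simp)

/-- The integral of `F f g` for two solutions `f`, `g` of `u'' = (W - a²) u`, `u'' = (W - b²) u`. -/
theorem integral_mul_solutions {W W₁ F F₁ F₂ F₃ F₄ f f₁ g g₁ : ℝ → ℝ} {a b : ℝ}
    (hW : HasDerivIcc W W₁) (hW₁ : ContinuousOn W₁ (Icc 0 1))
    (hF : HasDerivIcc F F₁) (hF₁ : HasDerivIcc F₁ F₂) (hF₂ : HasDerivIcc F₂ F₃)
    (hF₃ : HasDerivIcc F₃ F₄) (hF₄ : ContinuousOn F₄ (Icc 0 1))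
    (hf : HasDerivIcc f f₁) (hf₁ : HasDerivIcc f₁ (fun x => (W x - a ^ 2) * f x))
    (hg : HasDerivIcc g g₁) (hg₁ : HasDerivIcc g₁ (fun x => (W x - b ^ 2) * g x))
    (hf0 : f 0 = 0) (hf1 : f 1 = 0) (hg0 : g 0 = 0) (hg1 : g 1 = 0) :
    (a ^ 2 - b ^ 2) ^ 2 / 2 * ∫ x in (0 : ℝ)..1, F x * (f x * g x) =
      F₁ 1 * f₁ 1 * g₁ 1 - F₁ 0 * f₁ 0 * g₁ 0
      - (∫ x in (0 : ℝ)..1, (F₄ x / 2 - 2 * F₂ x * W x - F₁ x * W₁ x) * (f x * g x))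
      - (a ^ 2 + b ^ 2) * ∫ x in (0 : ℝ)..1, F₂ x * (f x * g x) := by
  have cW := hW.continuousOn
  have cF := hF.continuousOn
  have cF₁ := hF₁.continuousOn
  have cF₂ := hF₂.continuousOn
  have cf := hf.continuousOn
  have cg := hg.continuousOn
  -- The Wronskian `f g₁ - f₁ g` has derivative `(a² - b²) f g`. The `F₁` terms cancel the Wronskian
  -- term left over when `F` is differentiated; the `F₂` and `F₃` terms remove `f₁ g₁` and `(f g)'`.
  -- At the endpoints only `F₁ f₁ g₁` survives.
  have hG : HasDerivIcc (fun x => (a ^ 2 - b ^ 2) / 2 * F x * (f x * g₁ x - f₁ x * g x)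
      + F₁ x * (f₁ x * g₁ x) - F₁ x * (W x - (a ^ 2 + b ^ 2) / 2) * (f x * g x)
      - F₂ x / 2 * (f₁ x * g x + f x * g₁ x) + F₃ x / 2 * (f x * g x))
      (fun x => (a ^ 2 - b ^ 2) ^ 2 / 2 * (F x * (f x * g x))
        + (F₄ x / 2 - 2 * F₂ x * W x - F₁ x * W₁ x) * (f x * g x)
        + (a ^ 2 + b ^ 2) * (F₂ x * (f x * g x))) := by
    intro x hx
    have df := hf x hx
    have df₁ := hf₁ x hx
    have dg := hg x hx
    have dg₁ := hg₁ x hx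
    have dF := hF x hx
    have dF₁ := hF₁ x hx
    have dF₂ := hF₂ x hx
    have dF₃ := hF₃ x hx
    have dW := hW x hx
    refine ((((((dF.const_mul ((a ^ 2 - b ^ 2) / 2)).mul ((df.mul dg₁).sub (df₁.mul dg))).add
      (dF₁.mul (df₁.mul dg₁))).sub ((dF₁.mul (dW.sub_const _)).mul (df.mul dg))).sub
      ((dF₂.div_const 2).mul ((df₁.mul dg).add (df.mul dg₁)))).add
      ((dF₃.div_const 2).mul (df.mul dg))).congr_deriv ?_
    simp only [Pi.mul_apply, Pi.sub_apply, Pi.add_apply]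
    ring
  have ii : ∀ {h : ℝ → ℝ}, ContinuousOn h (Icc 0 1) → IntervalIntegrable h volume 0 1 :=
    fun h => h.intervalIntegrable_of_Icc zero_le_one
  have := hG.integral_eq_sub (by fun_prop) (right_mem_Icc.2 zero_le_one)
  rw [intervalIntegral.integral_add (ii (by fun_prop)) (ii (by fun_prop)),
    intervalIntegral.integral_add (ii (by fun_prop)) (ii (by fun_prop)),
    intervalIntegral.integral_const_mul, intervalIntegral.integral_const_mul] at this
  simp only [hf0, hf1, hg0, hg1] at this
  linear_combination this

/-- The potential that appears when `F` is multiplied twice by the difference of eigenvalues. -/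
noncomputable def lowerOrder (W F : ℝ → ℝ) : ℝ → ℝ := fun x =>
  derivIcc (derivIcc (derivIcc (derivIcc F))) x / 2 - 2 * derivIcc (derivIcc F) x * W x
    - derivIcc F x * derivIcc W x

theorem ContDiffOn.lowerOrder (hW : ContDiffOn ℝ ∞ W (Icc 0 1))
    (hF : ContDiffOn ℝ ∞ F (Icc 0 1)) : ContDiffOn ℝ ∞ (lowerOrder W F) (Icc 0 1) :=
  ((hF.derivIcc.derivIcc.derivIcc.derivIcc.div_const 2).sub
    ((contDiffOn_const.mul hF.derivIcc.derivIcc).mul hW)).sub (hF.derivIcc.mul hW.derivIcc)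

end

/-! ### Bootstrapped bounds for matrix elements -/

namespace IsDirichletSystem
variable {W F : ℝ → ℝ} {w : ℕ+ → ℝ} {g g₁ : ℕ+ → ℝ → ℝ} {ρ : ℕ+ → ℝ}

theorem exists_abs_le (H : IsDirichletSystem W w g g₁ ρ) :
    ∃ G, 0 ≤ G ∧ ∀ n, |ρ n| ≤ G ∧ ∀ x ∈ Icc (0 : ℝ) 1, |g n x| ≤ G := by
  obtain ⟨C, hC⟩ := H.asymp
  have h1 : ∀ n : ℕ+, C / n ≤ |C| := fun n => by
    have hn : (1 : ℝ) ≤ n := Nat.one_le_cast.2 n.pos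
    calc C / n ≤ |C| / n := by gcongr; exact le_abs_self C
      _ ≤ |C| := div_le_self (abs_nonneg _) hn
  refine ⟨1 + |C|, by positivity, fun n => ⟨?_, fun x hx => ?_⟩⟩
  · have h2 := (hC n).2.1.trans (h1 n)
    calc |ρ n| = |1 + (ρ n - 1)| := by ring_nf
      _ ≤ |1| + |ρ n - 1| := abs_add_le _ _
      _ ≤ _ := by rw [abs_one]; linarith
  · have h2 := ((hC n).2.2 x hx).trans (h1 n)
    calc |g n x| = |Real.sin (n * Real.pi * x) + (g n x - Real.sin (n * Real.pi * x))| := by ring_nf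
      _ ≤ |Real.sin (n * Real.pi * x)| + |g n x - Real.sin (n * Real.pi * x)| := abs_add_le _ _
      _ ≤ _ := add_le_add (Real.abs_sin_le_one _) h2

theorem exists_abs_integral_le (H : IsDirichletSystem W w g g₁ ρ)
    (hF : ContinuousOn F (Icc 0 1)) :
    ∃ C, 0 ≤ C ∧ ∀ p j, |∫ x in (0 : ℝ)..1, F x * (g p x * g j x)| ≤ C := by
  obtain ⟨G, hG0, hG⟩ := H.exists_abs_le
  obtain ⟨B, hB⟩ := isCompact_Icc.exists_bound_of_continuousOn hF
  have hB0 : 0 ≤ B := (norm_nonneg _).trans (hB 0 (left_mem_Icc.2 zero_le_one))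
  refine ⟨B * (G * G), by positivity, fun p j => ?_⟩
  have := intervalIntegral.norm_integral_le_of_norm_le_const (a := (0 : ℝ)) (b := 1)
    (f := fun x => F x * (g p x * g j x)) (C := B * (G * G)) ?_
  · simpa using this
  · intro x hx
    rw [uIoc_of_le zero_le_one] at hx
    have hx := Ioc_subset_Icc_self hx
    rw [norm_mul, norm_mul]
    gcongr
    · exact hB x hx
    · exact (hG p).2 x hx
    · exact (hG j).2 x hx

/-- The boundary term of `integral_mul_solutions`, divided by `w p * w j`. -/
noncomputable def boundaryCoeff (F : ℝ → ℝ) (ρ : ℕ+ → ℝ) (p j : ℕ+) : ℝ :=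
  (-1) ^ ((p : ℕ) + j) * (ρ p * ρ j) * derivIcc F 1 - derivIcc F 0

theorem integral_eq (H : IsDirichletSystem W w g g₁ ρ) (hW : ContDiffOn ℝ ∞ W (Icc 0 1))
    (hF : ContDiffOn ℝ ∞ F (Icc 0 1)) (p j : ℕ+) :
    (w p ^ 2 - w j ^ 2) ^ 2 / 2 * (∫ x in (0 : ℝ)..1, F x * (g p x * g j x)) =
      boundaryCoeff F ρ p j * (w p * w j)
      - (∫ x in (0 : ℝ)..1, lowerOrder W F x * (g p x * g j x))
      - (w p ^ 2 + w j ^ 2) *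
        ∫ x in (0 : ℝ)..1, derivIcc (derivIcc F) x * (g p x * g j x) := by
  rw [integral_mul_solutions hW.hasDerivIcc hW.derivIcc.continuousOn hF.hasDerivIcc
    hF.derivIcc.hasDerivIcc hF.derivIcc.derivIcc.hasDerivIcc
    hF.derivIcc.derivIcc.derivIcc.hasDerivIcc
    hF.derivIcc.derivIcc.derivIcc.derivIcc.continuousOn (H.deriv p) (H.deriv₂ p) (H.deriv j)
    (H.deriv₂ j) (H.left p) (H.right p) (H.left j) (H.right j)]
  simp only [H.deriv_left, H.deriv_right, boundaryCoeff, lowerOrder, pow_add]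
  ring

theorem one_le (H : IsDirichletSystem W w g g₁ ρ) (n : ℕ+) : 1 ≤ w n := by
  have hn : (1 : ℝ) ≤ n := Nat.one_le_cast.2 n.pos
  have := H.le n
  nlinarith [Real.pi_gt_three]

theorem exists_abs_boundaryCoeff_le (H : IsDirichletSystem W w g g₁ ρ) (F : ℝ → ℝ) :
    ∃ C, 0 ≤ C ∧ ∀ p j, |boundaryCoeff F ρ p j| ≤ C := by
  obtain ⟨G, hG0, hG⟩ := H.exists_abs_le
  refine ⟨G * G * |derivIcc F 1| + |derivIcc F 0|, by positivity, fun p j => ?_⟩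
  refine (abs_sub _ _).trans (add_le_add ?_ le_rfl)
  rw [abs_mul, abs_mul, abs_mul, abs_pow, abs_neg, abs_one, one_pow, one_mul]
  gcongr
  · exact (hG p).1
  · exact (hG j).1

/-- First round of the bootstrap: all integrals on the right of `integral_eq` are bounded trivially.
-/
theorem exists_abs_integral_le_sq (H : IsDirichletSystem W w g g₁ ρ)
    (hW : ContDiffOn ℝ ∞ W (Icc 0 1)) (hF : ContDiffOn ℝ ∞ F (Icc 0 1)) :
    ∃ C, 0 ≤ C ∧ ∀ p j, (w p ^ 2 - w j ^ 2) ^ 2 * |∫ x in (0 : ℝ)..1, F x * (g p x * g j x)|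
      ≤ C * (w p + w j) ^ 2 := by
  obtain ⟨C₁, h₁, hC₁⟩ := H.exists_abs_boundaryCoeff_le F
  obtain ⟨C₂, h₂, hC₂⟩ := H.exists_abs_integral_le (hW.lowerOrder hF).continuousOn
  obtain ⟨C₃, h₃, hC₃⟩ := H.exists_abs_integral_le hF.derivIcc.derivIcc.continuousOn
  refine ⟨2 * (C₁ + C₂ + C₃), by positivity, fun p j => ?_⟩
  have hp := H.one_le p
  have hj := H.one_le j
  have e := congrArg abs (H.integral_eq hW hF p j)
  rw [abs_mul, abs_of_nonneg (by positivity : 0 ≤ (w p ^ 2 - w j ^ 2) ^ 2 / 2)] at e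
  have t₁ : |boundaryCoeff F ρ p j * (w p * w j)| ≤ C₁ * (w p + w j) ^ 2 := by
    rw [abs_mul, abs_of_nonneg (by positivity : 0 ≤ w p * w j)]
    gcongr
    · exact hC₁ p j
    · nlinarith
  have t₂ : |∫ x in (0 : ℝ)..1, lowerOrder W F x * (g p x * g j x)| ≤ C₂ * (w p + w j) ^ 2 :=
    (hC₂ p j).trans (le_mul_of_one_le_right h₂ (by nlinarith))
  have t₃ : |(w p ^ 2 + w j ^ 2) *
      ∫ x in (0 : ℝ)..1, derivIcc (derivIcc F) x * (g p x * g j x)| ≤ C₃ * (w p + w j) ^ 2 := by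
    rw [abs_mul, abs_of_nonneg (by positivity : 0 ≤ w p ^ 2 + w j ^ 2), mul_comm]
    gcongr
    · exact hC₃ p j
    · nlinarith
  have := (abs_sub _ _).trans (add_le_add ((abs_sub (boundaryCoeff F ρ p j * (w p * w j))
    (∫ x in (0 : ℝ)..1, lowerOrder W F x * (g p x * g j x))).trans (add_le_add t₁ t₂)) t₃)
  rw [← e] at this
  linarith

/-- Second round: the previous bound, applied to `F''`, gains `(w j - w p)⁻²`, which compensates for
`w p ^ 2 + w j ^ 2` exceeding `w p * w j`. -/
theorem exists_abs_integral_le_mul (H : IsDirichletSystem W w g g₁ ρ)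
    (hW : ContDiffOn ℝ ∞ W (Icc 0 1)) (hF : ContDiffOn ℝ ∞ F (Icc 0 1)) :
    ∃ C, 0 ≤ C ∧ ∀ p j, 1 ≤ w j - w p →
      (w p ^ 2 - w j ^ 2) ^ 2 * |∫ x in (0 : ℝ)..1, F x * (g p x * g j x)| ≤ C * (w p * w j) := by
  obtain ⟨C₁, h₁, hC₁⟩ := H.exists_abs_boundaryCoeff_le F
  obtain ⟨C₂, h₂, hC₂⟩ := H.exists_abs_integral_le (hW.lowerOrder hF).continuousOn
  obtain ⟨C₃, h₃, hC₃⟩ := H.exists_abs_integral_le_sq hW hF.derivIcc.derivIcc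
  refine ⟨2 * (C₁ + C₂ + 3 * C₃), by positivity, fun p j hpj => ?_⟩
  have hp := H.one_le p
  have hj := H.one_le j
  have hpj1 : 1 ≤ w p * w j := by nlinarith
  have e := congrArg abs (H.integral_eq hW hF p j)
  rw [abs_mul, abs_of_nonneg (by positivity : 0 ≤ (w p ^ 2 - w j ^ 2) ^ 2 / 2)] at e
  have t₁ : |boundaryCoeff F ρ p j * (w p * w j)| ≤ C₁ * (w p * w j) := by
    rw [abs_mul, abs_of_nonneg (by positivity : 0 ≤ w p * w j)]
    gcongr
    exact hC₁ p j
  have t₂ : |∫ x in (0 : ℝ)..1, lowerOrder W F x * (g p x * g j x)| ≤ C₂ * (w p * w j) :=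
    (hC₂ p j).trans (le_mul_of_one_le_right h₂ hpj1)
  have t₃ : |(w p ^ 2 + w j ^ 2) *
      ∫ x in (0 : ℝ)..1, derivIcc (derivIcc F) x * (g p x * g j x)| ≤ 3 * C₃ * (w p * w j) := by
    rw [abs_mul, abs_of_nonneg (by positivity : 0 ≤ w p ^ 2 + w j ^ 2)]
    set I := |∫ x in (0 : ℝ)..1, derivIcc (derivIcc F) x * (g p x * g j x)|
    have hI : (w j - w p) ^ 2 * I ≤ C₃ := by
      have := hC₃ p j
      have hs : 0 < (w p + w j) ^ 2 := by positivity
      refine le_of_mul_le_mul_right ?_ hs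
      calc _ = (w p ^ 2 - w j ^ 2) ^ 2 * I := by ring
        _ ≤ _ := this
    have hI0 : 0 ≤ I := abs_nonneg _
    have hT : 1 ≤ (w j - w p) ^ 2 := one_le_pow₀ hpj
    -- The left side is `(w j - w p)² + 2 w p w j`, and both `w p * w j` and the squared gap are at
    -- least `1`.
    have : w p ^ 2 + w j ^ 2 ≤ 3 * (w p * w j) * (w j - w p) ^ 2 := by nlinarith
    calc _ ≤ 3 * (w p * w j) * (w j - w p) ^ 2 * I := by gcongr
      _ = 3 * (w p * w j) * ((w j - w p) ^ 2 * I) := by ring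
      _ ≤ 3 * (w p * w j) * C₃ := by gcongr
      _ = _ := by ring
  have := (abs_sub _ _).trans (add_le_add ((abs_sub (boundaryCoeff F ρ p j * (w p * w j))
    (∫ x in (0 : ℝ)..1, lowerOrder W F x * (g p x * g j x))).trans (add_le_add t₁ t₂)) t₃)
  rw [← e] at this
  linarith

/-- Asymptotics of the matrix elements away from the diagonal. -/
theorem exists_abs_integral_sub_boundary_le (H : IsDirichletSystem W w g g₁ ρ)
    (hW : ContDiffOn ℝ ∞ W (Icc 0 1)) (hF : ContDiffOn ℝ ∞ F (Icc 0 1)) :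
    ∃ C, 0 ≤ C ∧ ∀ p j, 1 ≤ w j - w p →
      |(w p ^ 2 - w j ^ 2) ^ 2 / 2 * (∫ x in (0 : ℝ)..1, F x * (g p x * g j x))
        - boundaryCoeff F ρ p j * (w p * w j)| * (w j - w p) ^ 2 ≤ C * (w p * w j) := by
  obtain ⟨C₂, h₂, hC₂⟩ := H.exists_abs_integral_le_mul hW (hW.lowerOrder hF)
  obtain ⟨C₃, h₃, hC₃⟩ := H.exists_abs_integral_le_mul hW hF.derivIcc.derivIcc
  refine ⟨C₂ + C₃, by positivity, fun p j hpj => ?_⟩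
  have hp := H.one_le p
  have hj := H.one_le j
  have hs : 0 < (w p + w j) ^ 2 := by positivity
  have hs1 : 1 ≤ (w p + w j) ^ 2 := by nlinarith
  have hs2 : w p ^ 2 + w j ^ 2 ≤ (w p + w j) ^ 2 := by nlinarith
  set I₂ := ∫ x in (0 : ℝ)..1, lowerOrder W F x * (g p x * g j x)
  set I₃ := ∫ x in (0 : ℝ)..1, derivIcc (derivIcc F) x * (g p x * g j x)
  have e : (w p ^ 2 - w j ^ 2) ^ 2 / 2 * (∫ x in (0 : ℝ)..1, F x * (g p x * g j x))
      - boundaryCoeff F ρ p j * (w p * w j) = -(I₂ + (w p ^ 2 + w j ^ 2) * I₃) := by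
    rw [H.integral_eq hW hF p j]; ring
  rw [e, abs_neg]
  -- Multiplying by `(w p + w j)²` completes `(w j - w p)²` to the squared eigenvalue difference, so
  -- the second-round bound applies to both remainder integrals.
  refine le_of_mul_le_mul_right ?_ hs
  have a₂ := hC₂ p j hpj
  have a₃ := hC₃ p j hpj
  have b : |I₂ + (w p ^ 2 + w j ^ 2) * I₃| ≤ (w p + w j) ^ 2 * (|I₂| + |I₃|) := by
    refine (abs_add_le _ _).trans ?_
    rw [abs_mul, abs_of_nonneg (by positivity : 0 ≤ w p ^ 2 + w j ^ 2), mul_add]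
    gcongr
    exact le_mul_of_one_le_left (abs_nonneg _) hs1
  calc _ ≤ (w p + w j) ^ 2 * (|I₂| + |I₃|) * (w j - w p) ^ 2 * (w p + w j) ^ 2 := by gcongr
    _ = ((w p ^ 2 - w j ^ 2) ^ 2 * |I₂| + (w p ^ 2 - w j ^ 2) ^ 2 * |I₃|) * (w p + w j) ^ 2 := by
      ring
    _ ≤ (C₂ * (w p * w j) + C₃ * (w p * w j)) * (w p + w j) ^ 2 := by gcongr
    _ = _ := by ring

end IsDirichletSystem

/-! ### Lower bounds near and far from the diagonal -/

theorem exists_pos_le_abs_of_tendsto {s : ℕ+ → ℝ} {L : ℝ}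
    (hs : Filter.Tendsto s Filter.atTop (nhds L)) (hL : L ≠ 0) (h0 : ∀ n, s n ≠ 0) :
    ∃ c, 0 < c ∧ ∀ n, c ≤ |s n| := by
  have hL' : 0 < |L| := abs_pos.2 hL
  obtain ⟨N, hN⟩ := Filter.eventually_atTop.1
    (hs.abs.eventually (lt_mem_nhds (half_lt_self hL')))
  obtain ⟨i, -, hi⟩ := Finset.exists_min_image (Finset.Icc 1 N) (fun n => |s n|)
    ⟨1, Finset.mem_Icc.2 ⟨le_rfl, one_le⟩⟩
  refine ⟨min (|L| / 2) |s i|, lt_min (half_pos hL') (abs_pos.2 (h0 i)), fun n => ?_⟩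
  rcases le_total N n with h | h
  · exact (min_le_left _ _).trans (hN n h).le
  · exact (min_le_right _ _).trans (hi n (Finset.mem_Icc.2 ⟨one_le, h⟩))

theorem tendsto_const_div_pnat (C : ℝ) :
    Filter.Tendsto (fun n : ℕ+ => C / (n : ℝ)) Filter.atTop (nhds 0) :=
  (tendsto_const_div_atTop_nhds_zero_nat C).comp tendsto_PNat_val_atTop_atTop

/-- The Riemann-Lebesgue lemma for cosine coefficients, with a rate. -/
theorem exists_abs_integral_mul_cos_le {F F₁ : ℝ → ℝ} (hF : HasDerivIcc F F₁)
    (hF₁ : ContinuousOn F₁ (Icc 0 1)) :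
    ∃ C, 0 ≤ C ∧ ∀ k : ℕ+, |∫ x in (0 : ℝ)..1, F x * Real.cos (k * Real.pi * x)| ≤ C / k := by
  obtain ⟨B, hB⟩ := isCompact_Icc.exists_bound_of_continuousOn hF₁
  have hB0 : 0 ≤ B := (norm_nonneg _).trans (hB 0 (left_mem_Icc.2 zero_le_one))
  refine ⟨B, hB0, fun k => ?_⟩
  have hk : (1 : ℝ) ≤ k := Nat.one_le_cast.2 k.pos
  have cF := hF.continuousOn
  have hS : HasDerivIcc (fun x => F x * Real.sin (k * Real.pi * x))
      (fun x => F₁ x * Real.sin (k * Real.pi * x)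
        + k * Real.pi * (F x * Real.cos (k * Real.pi * x))) := by
    intro x hx
    refine ((hF x hx).mul
      ((hasDerivWithinAt_id x _).const_mul (k * Real.pi)).sin).congr_deriv ?_
    simp only [id]
    ring
  have e := hS.integral_eq_sub (by fun_prop) (right_mem_Icc.2 zero_le_one)
  have ii : ∀ {h : ℝ → ℝ}, ContinuousOn h (Icc 0 1) → IntervalIntegrable h volume 0 1 :=
    fun h => h.intervalIntegrable_of_Icc zero_le_one
  rw [intervalIntegral.integral_add (ii (by fun_prop)) (ii (by fun_prop)),
    intervalIntegral.integral_const_mul] at e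
  simp only [mul_one, Real.sin_nat_mul_pi, mul_zero, Real.sin_zero, sub_zero] at e
  have hb := intervalIntegral.norm_integral_le_of_norm_le_const (a := (0 : ℝ)) (b := 1)
    (f := fun x => F₁ x * Real.sin (k * Real.pi * x)) (C := B) ?_
  · rw [sub_zero, abs_one, mul_one, Real.norm_eq_abs] at hb
    set I := ∫ x in (0 : ℝ)..1, F x * Real.cos (k * Real.pi * x)
    have e2 : (k : ℝ) * Real.pi * |I| ≤ B := by
      have : (k : ℝ) * Real.pi * |I| = |k * Real.pi * I| := by
        rw [abs_mul, abs_of_nonneg (by positivity : 0 ≤ (k : ℝ) * Real.pi)]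
      rw [this, eq_neg_of_add_eq_zero_right e, abs_neg]
      exact hb
    rw [le_div_iff₀ (one_pos.trans_le hk)]
    refine le_trans ?_ e2
    have h1 : (1 : ℝ) ≤ Real.pi := by linarith [Real.pi_gt_three]
    calc |I| * k = k * 1 * |I| := by ring
      _ ≤ _ := by gcongr
  · intro x hx
    rw [uIoc_of_le zero_le_one] at hx
    rw [norm_mul]
    calc _ ≤ B * 1 := by
          gcongr
          · exact hB x (Ioc_subset_Icc_self hx)
          · exact Real.abs_sin_le_one _
      _ = B := mul_one B

namespace IsDirichletSystem
variable {W Q : ℝ → ℝ} {w : ℕ+ → ℝ} {g g₁ : ℕ+ → ℝ → ℝ} {ρ : ℕ+ → ℝ}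

theorem tendsto_ρ (H : IsDirichletSystem W w g g₁ ρ) :
    Filter.Tendsto ρ Filter.atTop (nhds 1) := by
  obtain ⟨C, hC⟩ := H.asymp
  rw [tendsto_iff_dist_tendsto_zero]
  exact squeeze_zero (fun _ => dist_nonneg) (fun n => (hC n).2.1) (tendsto_const_div_pnat C)

/-- The limit of the matrix elements along a parallel of the diagonal. -/
theorem tendsto_integral (H : IsDirichletSystem W w g g₁ ρ) (hQ : ContDiffOn ℝ ∞ Q (Icc 0 1))
    (m : ℕ) (j : ℕ+ → ℕ+) (hj : ∀ p, (j p : ℕ) = p + m) :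
    Filter.Tendsto (fun p => ∫ x in (0 : ℝ)..1, Q x * (g p x * g (j p) x)) Filter.atTop
      (nhds ((∫ x in (0 : ℝ)..1, Q x * Real.cos (m * Real.pi * x)) / 2)) := by
  obtain ⟨C, hC⟩ := H.asymp
  obtain ⟨G, hG0, hG⟩ := H.exists_abs_le
  obtain ⟨B, hB⟩ := isCompact_Icc.exists_bound_of_continuousOn hQ.continuousOn
  have hB0 : 0 ≤ B := (norm_nonneg _).trans (hB 0 (left_mem_Icc.2 zero_le_one))
  obtain ⟨D, hD0, hD⟩ := exists_abs_integral_mul_cos_le hQ.hasDerivIcc hQ.derivIcc.continuousOn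
  have cQ := hQ.continuousOn
  have cg := fun n => (H.deriv n).continuousOn
  have ii : ∀ {h : ℝ → ℝ}, ContinuousOn h (Icc 0 1) → IntervalIntegrable h volume 0 1 :=
    fun h => h.intervalIntegrable_of_Icc zero_le_one
  have hC0 : 0 ≤ C := by
    have := (abs_nonneg _).trans (hC 1).2.1
    simpa using this
  rw [tendsto_iff_dist_tendsto_zero]
  refine squeeze_zero (g := fun p : ℕ+ => (B * (G * C + C) + D) / (p : ℝ))
    (fun _ => dist_nonneg) (fun p => ?_) (tendsto_const_div_pnat _)
  have hp : (0 : ℝ) < p := Nat.cast_pos.2 p.pos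
  have hjp : (p : ℝ) ≤ j p := by
    rw [hj]; push_cast; linarith [(Nat.cast_nonneg m : (0 : ℝ) ≤ m)]
  have hjr : (j p : ℝ) = p + m := by rw [hj]; push_cast; rfl
  -- Replace eigenfunctions by sines and use product-to-sum: the difference frequency is the
  -- constant `m`, the sum frequency `p + j p` gives a Riemann–Lebesgue term.
  have e : ∀ x, Q x * (g p x * g (j p) x) = Q x * (g p x * g (j p) x
      - Real.sin (p * Real.pi * x) * Real.sin (j p * Real.pi * x))
      + (1 / 2 * (Q x * Real.cos (m * Real.pi * x))
      - 1 / 2 * (Q x * Real.cos ((p + j p : ℕ+) * Real.pi * x))) := by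
    intro x
    have h1 : (m : ℝ) * Real.pi * x = j p * Real.pi * x - p * Real.pi * x := by rw [hjr]; ring
    have h2 : ((p + j p : ℕ+) : ℝ) * Real.pi * x = j p * Real.pi * x + p * Real.pi * x := by
      push_cast; ring
    rw [h1, h2, Real.cos_sub, Real.cos_add]
    ring
  simp only [e]
  rw [intervalIntegral.integral_add (ii (by fun_prop)) (ii (by fun_prop)),
    intervalIntegral.integral_sub (ii (by fun_prop)) (ii (by fun_prop)),
    intervalIntegral.integral_const_mul, intervalIntegral.integral_const_mul, Real.dist_eq]
  have t₁ := intervalIntegral.norm_integral_le_of_norm_le_const (a := (0 : ℝ)) (b := 1)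
    (f := fun x => Q x * (g p x * g (j p) x
      - Real.sin (p * Real.pi * x) * Real.sin (j p * Real.pi * x)))
    (C := B * ((G * C + C) / p)) ?_
  · rw [sub_zero, abs_one, mul_one, Real.norm_eq_abs] at t₁
    have t₂ := hD (p + j p)
    have t₃ : D / ((p + j p : ℕ+) : ℝ) ≤ D / p := by
      gcongr
      push_cast
      linarith [(Nat.cast_nonneg (j p : ℕ) : (0 : ℝ) ≤ (j p : ℕ))]
    have t₄ : 0 ≤ D / p := by positivity
    set I₁ := ∫ x in (0 : ℝ)..1, Q x * (g p x * g (j p) x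
      - Real.sin (p * Real.pi * x) * Real.sin (j p * Real.pi * x))
    set I₂ := ∫ x in (0 : ℝ)..1, Q x * Real.cos (m * Real.pi * x)
    set I₃ := ∫ x in (0 : ℝ)..1, Q x * Real.cos ((p + j p : ℕ+) * Real.pi * x)
    have e2 : I₁ + (1 / 2 * I₂ - 1 / 2 * I₃) - I₂ / 2 = I₁ - I₃ / 2 := by ring
    rw [e2]
    refine (abs_sub _ _).trans ?_
    rw [abs_div, abs_two]
    have e3 : (B * (G * C + C) + D) / (p : ℝ) = B * ((G * C + C) / p) + D / p := by ring
    rw [e3]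
    linarith
  · intro x hx
    rw [uIoc_of_le zero_le_one] at hx
    have hx := Ioc_subset_Icc_self hx
    rw [norm_mul]
    gcongr
    · exact hB x hx
    · have a₁ := (hC p).2.2 x hx
      have a₂ : |g (j p) x - Real.sin (j p * Real.pi * x)| ≤ C / p :=
        ((hC (j p)).2.2 x hx).trans (by gcongr)
      have e3 : g p x * g (j p) x - Real.sin (p * Real.pi * x) * Real.sin (j p * Real.pi * x)
        = g p x * (g (j p) x - Real.sin (j p * Real.pi * x))
          + (g p x - Real.sin (p * Real.pi * x)) * Real.sin (j p * Real.pi * x) := by ring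
      rw [e3, Real.norm_eq_abs]
      refine (abs_add_le _ _).trans ?_
      rw [abs_mul, abs_mul]
      calc _ ≤ G * (C / p) + C / p * 1 := by
            gcongr
            · exact (hG p).2 x hx
            · exact Real.abs_sin_le_one _
        _ = _ := by ring

/-- Comparing absolute values disposes of the sign. `ρ j` is near `1` for large `j`, and `|ρ p
Q'(1)| - |Q'(0)|` is nonzero for every `p` with nonzero limit, hence bounded below uniformly in `p`.
-/
theorem exists_le_abs_boundaryCoeff (H : IsDirichletSystem W w g g₁ ρ)
    (h₁ : ∀ p, |ρ p * derivIcc Q 1| ≠ |derivIcc Q 0|) (h₂ : |derivIcc Q 1| ≠ |derivIcc Q 0|) :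
    ∃ c, 0 < c ∧ ∃ J : ℕ+, ∀ p j, J ≤ j → c ≤ |boundaryCoeff Q ρ p j| := by
  obtain ⟨G, hG0, hG⟩ := H.exists_abs_le
  have hlim : Filter.Tendsto (fun p => |ρ p * derivIcc Q 1| - |derivIcc Q 0|) Filter.atTop
      (nhds (|1 * derivIcc Q 1| - |derivIcc Q 0|)) :=
    (H.tendsto_ρ.mul_const _).abs.sub_const _
  rw [one_mul] at hlim
  obtain ⟨c, hc, hcle⟩ := exists_pos_le_abs_of_tendsto hlim (sub_ne_zero.2 h₂)
    (fun p => sub_ne_zero.2 (h₁ p))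
  have hlim₂ : Filter.Tendsto (fun j => G * |derivIcc Q 1| * |ρ j - 1|) Filter.atTop
      (nhds (G * |derivIcc Q 1| * |1 - 1|)) :=
    ((H.tendsto_ρ.sub_const 1).abs.const_mul _)
  rw [sub_self, abs_zero, mul_zero] at hlim₂
  obtain ⟨J, hJ⟩ := Filter.eventually_atTop.1 (hlim₂.eventually (gt_mem_nhds (half_pos hc)))
  refine ⟨c / 2, half_pos hc, J, fun p j hj => ?_⟩
  have b₁ : |ρ p * derivIcc Q 1 * (ρ j - 1)| ≤ G * |derivIcc Q 1| * |ρ j - 1| := by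
    rw [abs_mul, abs_mul]
    gcongr
    exact (hG p).1
  have b₂ := abs_abs_sub_abs_le (ρ p * ρ j * derivIcc Q 1) (ρ p * derivIcc Q 1)
  have e₂ : ρ p * ρ j * derivIcc Q 1 - ρ p * derivIcc Q 1 = ρ p * derivIcc Q 1 * (ρ j - 1) := by
    ring
  rw [e₂] at b₂
  have b₃ := abs_abs_sub_abs_le ((-1) ^ ((p : ℕ) + j) * (ρ p * ρ j) * derivIcc Q 1) (derivIcc Q 0)
  have e₃ : |(-1) ^ ((p : ℕ) + j) * (ρ p * ρ j) * derivIcc Q 1| = |ρ p * ρ j * derivIcc Q 1| := by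
    rw [mul_assoc, abs_mul, abs_pow, abs_neg, abs_one, one_pow, one_mul]
  rw [e₃] at b₃
  have b₄ := hJ j hj
  have b₅ := hcle p
  have b₆ : |(|ρ p * derivIcc Q 1| - |derivIcc Q 0|)| ≤
      |(|ρ p * ρ j * derivIcc Q 1| - |derivIcc Q 0|)| +
      |(|ρ p * ρ j * derivIcc Q 1| - |ρ p * derivIcc Q 1|)| := by
    have := abs_sub (|ρ p * ρ j * derivIcc Q 1| - |derivIcc Q 0|)
      (|ρ p * ρ j * derivIcc Q 1| - |ρ p * derivIcc Q 1|)
    rwa [sub_sub_sub_cancel_left] at this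
  rw [boundaryCoeff]
  linarith

theorem exists_le_offDiagonal (H : IsDirichletSystem W w g g₁ ρ)
    (hW : ContDiffOn ℝ ∞ W (Icc 0 1)) (hQ : ContDiffOn ℝ ∞ Q (Icc 0 1))
    (h₁ : ∀ p, |ρ p * derivIcc Q 1| ≠ |derivIcc Q 0|) (h₂ : |derivIcc Q 1| ≠ |derivIcc Q 0|) :
    ∃ c, 0 < c ∧ ∃ M : ℕ, ∀ p j : ℕ+, (p : ℕ) + M ≤ j →
      c ≤ (p : ℝ) ^ 3 * (j : ℝ) ^ 3 * |∫ x in (0 : ℝ)..1, Q x * (g p x * g j x)| := by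
  obtain ⟨c, hc, J, hJ⟩ := H.exists_le_abs_boundaryCoeff h₁ h₂
  obtain ⟨E, hE0, hE⟩ := H.exists_abs_integral_sub_boundary_le hW hQ
  obtain ⟨C, hC⟩ := H.asymp
  have hC0 : 0 ≤ C := by
    have := (abs_nonneg _).trans (hC 1).2.1
    simpa using this
  -- `M₀ ≥ C` absorbs the error in `w p`, so the gap exceeds `M₀`; `M₀ ≥ 2 * E / c` then makes the
  -- remainder at most half of the boundary term. Adding `J` forces `J ≤ j`.
  obtain ⟨M₀, hM₀⟩ := exists_nat_ge (max C (2 * E / c))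
  refine ⟨c / (Real.pi + C) ^ 4, by positivity, M₀ + J, fun p j hpj => ?_⟩
  have hp : (1 : ℝ) ≤ p := Nat.one_le_cast.2 p.pos
  have hj : (1 : ℝ) ≤ j := Nat.one_le_cast.2 j.pos
  have hJ1 : (1 : ℝ) ≤ J := Nat.one_le_cast.2 J.pos
  have hpj' : (p : ℝ) + (M₀ + J) ≤ j := by exact_mod_cast hpj
  have hJj : J ≤ j := by
    have : (J : ℕ) ≤ j := by omega
    exact_mod_cast this
  have hM1 := (le_max_left _ _).trans hM₀
  have hM2 := (le_max_right _ _).trans hM₀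
  have hpi := Real.pi_gt_three
  have hup : ∀ n : ℕ+, w n ≤ n * Real.pi + C := fun n => by
    have hn : (1 : ℝ) ≤ n := Nat.one_le_cast.2 n.pos
    have := div_le_self hC0 hn
    linarith [(hC n).1]
  have hgap : (M₀ : ℝ) + 1 ≤ w j - w p := by
    have a := H.le j
    have b := hup p
    nlinarith
  have hM0 : (0 : ℝ) ≤ M₀ := Nat.cast_nonneg _
  have wp := H.one_le p
  have wj := H.one_le j
  set I := ∫ x in (0 : ℝ)..1, Q x * (g p x * g j x)
  have hab : 0 < w p * w j := by positivity
  have k₁ := hE p j (by linarith)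
  have k₂ : |(w p ^ 2 - w j ^ 2) ^ 2 / 2 * I - boundaryCoeff Q ρ p j * (w p * w j)|
      ≤ c / 2 * (w p * w j) := by
    have hT : 0 < (w j - w p) ^ 2 := by
      have : 0 < w j - w p := by linarith
      positivity
    refine le_of_mul_le_mul_right (k₁.trans ?_) hT
    have h3 : E ≤ c / 2 * (w j - w p) ^ 2 := by
      have h4 : 2 * E / c ≤ (w j - w p) ^ 2 := by nlinarith
      rw [div_le_iff₀ hc] at h4
      linarith
    calc E * (w p * w j) ≤ c / 2 * (w j - w p) ^ 2 * (w p * w j) := by gcongr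
      _ = _ := by ring
  have k₃ : c * (w p * w j) ≤ |boundaryCoeff Q ρ p j * (w p * w j)| := by
    rw [abs_mul, abs_of_pos hab]
    gcongr
    exact hJ p j hJj
  have k₄ : c / 2 * (w p * w j) ≤ (w p ^ 2 - w j ^ 2) ^ 2 / 2 * |I| := by
    have := abs_sub_abs_le_abs_sub (boundaryCoeff Q ρ p j * (w p * w j))
      ((w p ^ 2 - w j ^ 2) ^ 2 / 2 * I)
    rw [abs_sub_comm (boundaryCoeff Q ρ p j * (w p * w j))] at this
    rw [← abs_of_nonneg (by positivity : 0 ≤ (w p ^ 2 - w j ^ 2) ^ 2 / 2), ← abs_mul]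
    linarith
  have hwj : w j ≤ (Real.pi + C) * j := by
    have := hup j
    nlinarith
  have k₅ : (w p ^ 2 - w j ^ 2) ^ 2 ≤ ((Real.pi + C) * j) ^ 4 := by
    have h1 : (w p ^ 2 - w j ^ 2) ^ 2 ≤ (w j ^ 2) ^ 2 := by
      apply sq_le_sq'
      · nlinarith
      · nlinarith
    calc _ ≤ (w j ^ 2) ^ 2 := h1
      _ = w j ^ 4 := by ring
      _ ≤ _ := by gcongr
  have hwpj : (j : ℝ) ≤ w p * w j := by
    have := H.le j
    nlinarith
  have k₆ : c * j ≤ ((Real.pi + C) * j) ^ 4 * |I| := by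
    calc c * j ≤ c * (w p * w j) := by gcongr
      _ ≤ (w p ^ 2 - w j ^ 2) ^ 2 * |I| := by linarith
      _ ≤ _ := by gcongr
  have hj0 : (0 : ℝ) < j := by linarith
  have k₇ : c ≤ (Real.pi + C) ^ 4 * ((j : ℝ) ^ 3 * |I|) := by
    refine le_of_mul_le_mul_right ?_ hj0
    calc c * j ≤ _ := k₆
      _ = _ := by ring
  rw [div_le_iff₀ (by positivity)]
  have hp3 : (1 : ℝ) ≤ (p : ℝ) ^ 3 := one_le_pow₀ hp
  calc c ≤ 1 * ((Real.pi + C) ^ 4 * ((j : ℝ) ^ 3 * |I|)) := by rwa [one_mul]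
    _ ≤ (p : ℝ) ^ 3 * ((Real.pi + C) ^ 4 * ((j : ℝ) ^ 3 * |I|)) := by gcongr
    _ = _ := by ring

/-- Countably many nondegeneracy conditions imply the lower bound on the matrix elements. -/
theorem exists_le_abs_integral (H : IsDirichletSystem W w g g₁ ρ)
    (hW : ContDiffOn ℝ ∞ W (Icc 0 1)) (hQ : ContDiffOn ℝ ∞ Q (Icc 0 1))
    (h₁ : ∀ p, |ρ p * derivIcc Q 1| ≠ |derivIcc Q 0|) (h₂ : |derivIcc Q 1| ≠ |derivIcc Q 0|)
    (h₃ : ∀ p j, ∫ x in (0 : ℝ)..1, Q x * (g p x * g j x) ≠ 0)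
    (h₄ : ∀ m : ℕ, ∫ x in (0 : ℝ)..1, Q x * Real.cos (m * Real.pi * x) ≠ 0) :
    ∃ c, 0 < c ∧ ∀ p j : ℕ+,
      c ≤ (p : ℝ) ^ 3 * (j : ℝ) ^ 3 * |∫ x in (0 : ℝ)..1, Q x * (g p x * g j x)| := by
  obtain ⟨c, hc, M, hM⟩ := H.exists_le_offDiagonal hW hQ h₁ h₂
  have hdiag : ∀ m : ℕ, ∃ c, 0 < c ∧ ∀ p j : ℕ+, (j : ℕ) = p + m →
      c ≤ (p : ℝ) ^ 3 * (j : ℝ) ^ 3 * |∫ x in (0 : ℝ)..1, Q x * (g p x * g j x)| := by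
    intro m
    obtain ⟨c, hc, h⟩ := exists_pos_le_abs_of_tendsto
      (H.tendsto_integral hQ m (fun p => ⟨p + m, by positivity⟩) (fun p => rfl))
      (div_ne_zero (h₄ m) two_ne_zero) (fun p => h₃ _ _)
    refine ⟨c, hc, fun p j hpj => ?_⟩
    obtain rfl : j = ⟨p + m, by positivity⟩ := PNat.eq hpj
    refine (h p).trans (le_mul_of_one_le_left (abs_nonneg _) ?_)
    exact one_le_mul_of_one_le_of_one_le (one_le_pow₀ (Nat.one_le_cast.2 (PNat.pos _)))
      (one_le_pow₀ (Nat.one_le_cast.2 (PNat.pos _)))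
  choose d hd hd' using hdiag
  -- Only `m < M` is needed; `M + 1` keeps the range nonempty.
  obtain ⟨i, -, hi⟩ := Finset.exists_min_image (Finset.range (M + 1)) d ⟨0, by simp⟩
  have key : ∀ p j : ℕ+, p ≤ j → min c (d i) ≤
      (p : ℝ) ^ 3 * (j : ℝ) ^ 3 * |∫ x in (0 : ℝ)..1, Q x * (g p x * g j x)| := by
    intro p j hpj
    have hpj : (p : ℕ) ≤ j := hpj
    by_cases h : (p : ℕ) + M ≤ j
    · exact (min_le_left _ _).trans (hM p j h)
    · refine (min_le_right _ _).trans ((hi (j - p) ?_).trans (hd' (j - p) p j ?_))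
      · rw [Finset.mem_range]; omega
      · omega
  refine ⟨min c (d i), lt_min hc (hd i), fun p j => ?_⟩
  rcases le_total p j with h | h
  · exact key p j h
  · have := key j p h
    simp only [mul_comm (g j _) (g p _)] at this
    rwa [mul_comm ((j : ℝ) ^ 3)] at this

end IsDirichletSystem

/-! ### Functionals evaluated on exponentials -/

theorem differentiable_integral_exp_mul {h : ℝ → ℂ} (hh : ContinuousOn h (Icc 0 1)) :
    Differentiable ℂ (fun z : ℂ => ∫ x in (0 : ℝ)..1, Complex.exp (z * x) * h x) := by
  intro z
  obtain ⟨B, hB⟩ := isCompact_Icc.exists_bound_of_continuousOn hh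
  have hB0 : 0 ≤ B := (norm_nonneg _).trans (hB 0 (left_mem_Icc.2 zero_le_one))
  have hm : ∀ k : ℝ → ℂ, ContinuousOn k (Icc 0 1) →
      AEStronglyMeasurable k (volume.restrict (uIoc 0 1)) := by
    intro k hk
    rw [uIoc_of_le zero_le_one]
    exact (hk.mono Ioc_subset_Icc_self).aestronglyMeasurable measurableSet_Ioc
  have := (intervalIntegral.hasDerivAt_integral_of_dominated_loc_of_deriv_le (μ := volume)
    (a := (0 : ℝ)) (b := 1) (F := fun z x => Complex.exp (z * x) * h x)
    (F' := fun z x => Complex.exp (z * x) * x * h x) (x₀ := z) (s := Metric.ball z 1)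
    (bound := fun _ => Real.exp (‖z‖ + 1) * 1 * B) (Metric.ball_mem_nhds z one_pos)
    (Filter.Eventually.of_forall fun z => hm _ (by fun_prop)) ?_ (hm _ (by fun_prop)) ?_ ?_ ?_).2
  · exact this.differentiableAt
  · exact ContinuousOn.intervalIntegrable_of_Icc zero_le_one (by fun_prop)
  · refine Filter.Eventually.of_forall fun x hx y hy => ?_
    rw [uIoc_of_le zero_le_one] at hx
    have hy' : ‖y‖ ≤ ‖z‖ + 1 := by
      have := norm_le_norm_add_norm_sub' y z
      rw [Metric.mem_ball, dist_eq_norm] at hy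
      linarith
    have hx1 : ‖(x : ℂ)‖ ≤ 1 := by
      rw [Complex.norm_real, Real.norm_of_nonneg hx.1.le]; exact hx.2
    rw [norm_mul, norm_mul, Complex.norm_exp]
    gcongr
    · refine (Complex.re_le_norm _).trans ?_
      rw [norm_mul]
      exact (mul_le_of_le_one_right (norm_nonneg _) hx1).trans hy'
    · exact hB x (Ioc_subset_Icc_self hx)
  · exact intervalIntegrable_const
  · refine Filter.Eventually.of_forall fun x _ y _ => ?_
    have := (((hasDerivAt_id y).mul_const (x : ℂ)).cexp).mul_const (h x)
    simpa using this

/-- The integral extends to an entire function of `t`. Unless it vanishes on the whole real line,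
its real zeros are discrete, hence countable. If it did vanish there, it would vanish on `ℂ`; at
integer multiples of `2πi` this kills all Fourier coefficients of `h`, and Parseval contradicts `h
x₀ ≠ 0`. -/
theorem countable_integral_exp_mul_eq_zero {h : ℝ → ℝ} (hh : ContinuousOn h (Icc 0 1)) {x₀ : ℝ}
    (hx₀ : x₀ ∈ Icc (0 : ℝ) 1) (hne : h x₀ ≠ 0) :
    {t : ℝ | ∫ x in (0 : ℝ)..1, Real.exp (t * x) * h x = 0}.Countable := by
  have hhc : ContinuousOn (fun x => (h x : ℂ)) (Icc 0 1) :=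
    Complex.continuous_ofReal.comp_continuousOn hh
  set f : ℂ → ℂ := fun z => ∫ x in (0 : ℝ)..1, Complex.exp (z * x) * (h x : ℂ)
  have hf : Differentiable ℂ f := differentiable_integral_exp_mul hhc
  have hfr : ∀ t : ℝ, f t = ((∫ x in (0 : ℝ)..1, Real.exp (t * x) * h x : ℝ) : ℂ) := by
    intro t
    rw [← intervalIntegral.integral_ofReal]
    simp [f]
  have han : AnalyticOnNhd ℝ (fun t : ℝ => f t) univ := fun t _ =>
    ((hf.analyticAt (t : ℂ)).restrictScalars (𝕜 := ℝ)).comp (Complex.ofRealCLM.analyticAt t)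
  by_cases hz : ∃ t : ℝ, f t ≠ 0
  · obtain ⟨t, ht⟩ := hz
    have h1 := han.preimage_zero_mem_codiscrete ht
    have := isDiscrete_iff_discreteTopology.1 (mem_codiscrete'.1 h1).2
    have h2 : ((fun t : ℝ => f t) ⁻¹' {0}ᶜ)ᶜ.Countable :=
      TopologicalSpace.separableSpace_iff_countable.1 inferInstance
    refine h2.mono fun s hs => ?_
    simp only [mem_compl_iff, mem_preimage, mem_singleton_iff, not_not]
    rw [hfr, hs]
    simp
  · exfalso
    push Not at hz
    have hf0 : f = fun _ => 0 := by
      refine AnalyticOnNhd.eq_of_frequently_eq (z₀ := 0) (fun z _ => hf.analyticAt z)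
        (fun z _ => analyticAt_const) ?_
      have ht : Filter.Tendsto (fun t : ℝ => (t : ℂ)) (nhdsWithin 0 {0}ᶜ)
          (nhdsWithin 0 {0}ᶜ) := by
        refine tendsto_nhdsWithin_iff.2 ⟨?_, ?_⟩
        · exact (Complex.continuous_ofReal.tendsto' 0 0 Complex.ofReal_zero).mono_left
            nhdsWithin_le_nhds
        · filter_upwards [self_mem_nhdsWithin] with t ht
          simpa using ht
      exact ht.frequently (Filter.Frequently.of_forall hz)
    have hcoef : ∀ n : ℤ, fourierCoeffOn one_pos (fun x => (h x : ℂ)) n = 0 := by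
      intro n
      have := congrFun hf0 (2 * Real.pi * Complex.I * (-n : ℤ))
      rw [fourierCoeffOn_eq_integral]
      simp only [f] at this
      simp only [fourier_coe_apply, smul_eq_mul]
      rw [show (∫ x in (0 : ℝ)..1, Complex.exp (2 * Real.pi * Complex.I * (-n : ℤ) * x
          / ((1 - 0 : ℝ) : ℂ)) * (h x : ℂ)) = 0 by simpa using this, smul_zero]
    have hB := isCompact_Icc.exists_bound_of_continuousOn hhc
    obtain ⟨B, hB⟩ := hB
    have hs := hasSum_sq_fourierCoeffOn one_pos (f := fun x => (h x : ℂ))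
      (MemLp.of_bound ((hhc.mono Ioc_subset_Icc_self).aestronglyMeasurable measurableSet_Ioc) B
        ((ae_restrict_iff' measurableSet_Ioc).2
          (Filter.Eventually.of_forall fun x hx => hB x (Ioc_subset_Icc_self hx))))
    simp only [hcoef, norm_zero, ne_eq, OfNat.ofNat_ne_zero, not_false_eq_true, zero_pow] at hs
    have h0 := hs.unique hasSum_zero
    have hpos : 0 < ∫ x in (0 : ℝ)..1, ‖(h x : ℂ)‖ ^ 2 := by
      refine intervalIntegral.integral_pos one_pos (hhc.norm.pow 2) (fun x _ => sq_nonneg _)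
        ⟨x₀, hx₀, ?_⟩
      have : ‖(h x₀ : ℂ)‖ ≠ 0 := by simpa using hne
      positivity
    rw [sub_zero, inv_one, one_smul] at h0
    exact hpos.ne' h0

theorem countable_mul_exp_add_eq_zero (a b : ℝ) (h : a ≠ 0 ∨ b ≠ 0) :
    {t : ℝ | a * (t * Real.exp t) + b * t = 0}.Countable := by
  have hsub : {t : ℝ | a * (t * Real.exp t) + b * t = 0} ⊆ {0, Real.log (-b / a)} := by
    intro t ht
    by_cases ht0 : t = 0
    · exact Or.inl ht0
    right
    have h1 : a * Real.exp t + b = 0 := by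
      have : t * (a * Real.exp t + b) = 0 := by
        have ht : a * (t * Real.exp t) + b * t = 0 := ht
        linear_combination ht
      exact (mul_eq_zero.1 this).resolve_left ht0
    have ha : a ≠ 0 := by
      rintro rfl
      simp at h h1
      exact h h1
    have h2 : Real.exp t = -b / a := by
      rw [eq_div_iff ha]; linear_combination h1
    rw [mem_singleton_iff, ← h2, Real.log_exp]
  exact (Set.toFinite _).countable.mono hsub

/-! ### Density in the Fréchet space -/

namespace SmoothIcc

theorem toFun_add (f g : SmoothIcc) (x : ℝ) : (f + g) x = f x + g x := rfl

theorem toFun_smul (c : ℝ) (f : SmoothIcc) (x : ℝ) : (c • f) x = c * f x := rfl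

/-- The derivative at a point, as a linear functional. -/
noncomputable def derivFunctional (x : ℝ) : SmoothIcc →ₗ[ℝ] ℝ where
  toFun Q := derivMap 1 Q (projIcc 0 1 zero_le_one x)
  map_add' f g := by simp
  map_smul' c f := by simp

theorem derivFunctional_apply (Q : SmoothIcc) {x : ℝ} (hx : x ∈ Icc (0 : ℝ) 1) :
    derivFunctional x Q = derivIcc Q x := by
  change iteratedDerivWithin 1 Q (Icc 0 1) (projIcc 0 1 zero_le_one x) = derivIcc Q x
  rw [projIcc_of_mem zero_le_one hx, iteratedDerivWithin_one]
  rfl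

/-- Integration against a continuous function, as a linear functional. -/
noncomputable def integralFunctional (h : ℝ → ℝ) (hh : ContinuousOn h (Icc 0 1)) : SmoothIcc →ₗ[ℝ] ℝ where
  toFun Q := ∫ x in (0 : ℝ)..1, Q x * h x
  map_add' f g := by
    simp only [toFun_add, add_mul]
    exact intervalIntegral.integral_add
      ((f.continuousOn.mul hh).intervalIntegrable_of_Icc zero_le_one)
      ((g.continuousOn.mul hh).intervalIntegrable_of_Icc zero_le_one)
  map_smul' c f := by
    simp only [toFun_smul, mul_assoc]
    exact intervalIntegral.integral_const_mul _ _

/-- The function `x ↦ exp (t x)`. -/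
noncomputable def expMul (t : ℝ) : SmoothIcc :=
  ⟨fun x => Real.exp (t * x), by
    have : ContDiffOn ℝ ∞ (fun x : ℝ => Real.exp (t * x)) (Icc 0 1) := by fun_prop
    exact this.congr fun x hx => IccExtend_of_mem _ _ hx⟩

theorem expMul_apply (t : ℝ) {x : ℝ} (hx : x ∈ Icc (0 : ℝ) 1) : expMul t x = Real.exp (t * x) :=
  IccExtend_of_mem (zero_le_one' ℝ) (fun x : Icc (0 : ℝ) 1 => Real.exp (t * x)) hx

theorem derivIcc_expMul (t : ℝ) {x : ℝ} (hx : x ∈ Icc (0 : ℝ) 1) :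
    derivIcc (expMul t) x = t * Real.exp (t * x) := by
  have h : HasDerivWithinAt (fun x : ℝ => Real.exp (t * x)) (t * Real.exp (t * x)) (Icc 0 1) x := by
    refine ((hasDerivWithinAt_id x _).const_mul t).exp.congr_deriv ?_
    simp [mul_comm]
  exact (h.congr (fun y hy => expMul_apply t hy) (expMul_apply t hx)).derivWithin
    (uniqueDiffOn_Icc one_pos x hx)

theorem countable_integralFunctional_expMul {h : ℝ → ℝ} (hh : ContinuousOn h (Icc 0 1)) {x₀ : ℝ}
    (hx₀ : x₀ ∈ Icc (0 : ℝ) 1) (hne : h x₀ ≠ 0) :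
    {t : ℝ | integralFunctional h hh (expMul t) = 0}.Countable := by
  convert countable_integral_exp_mul_eq_zero hh hx₀ hne using 4 with t
  refine intervalIntegral.integral_congr fun x hx => ?_
  rw [uIcc_of_le zero_le_one] at hx
  simp only [expMul_apply t hx]

theorem countable_derivFunctional_expMul {a b : ℝ} (h : a ≠ 0 ∨ b ≠ 0) :
    {t : ℝ | (a • derivFunctional 1 + b • derivFunctional 0) (expMul t) = 0}.Countable := by
  convert countable_mul_exp_add_eq_zero a b h using 4 with t
  simp only [LinearMap.add_apply, LinearMap.smul_apply, smul_eq_mul,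
    derivFunctional_apply _ (left_mem_Icc.2 (zero_le_one' ℝ)),
    derivFunctional_apply _ (right_mem_Icc.2 (zero_le_one' ℝ)),
    derivIcc_expMul _ (left_mem_Icc.2 (zero_le_one' ℝ)),
    derivIcc_expMul _ (right_mem_Icc.2 (zero_le_one' ℝ))]
  simp

/-- Countably many linear functionals that vanish at `expMul t` for only countably many `t` are
simultaneously nonzero on a dense set. -/
theorem dense_forall_ne_zero {S : Set (SmoothIcc →ₗ[ℝ] ℝ)} (hS : S.Countable)
    (h : ∀ l ∈ S, {t : ℝ | l (expMul t) = 0}.Countable) : Dense {Q | ∀ l ∈ S, l Q ≠ 0} := by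
  -- One `t` outside a countable set serves all functionals at once.
  obtain ⟨t, ht⟩ := (hS.biUnion h).dense_compl ℝ |>.nonempty
  have ht : ∀ l ∈ S, l (expMul t) ≠ 0 := fun l hl h0 => ht (mem_biUnion hl h0)
  have := withSeminorms.topologicalAddGroup
  have := withSeminorms.continuousSMul
  intro Q
  -- On the line `Q + s • expMul t` each functional is affine in `s` with nonzero slope, so it has
  -- one zero. Hence good `s` accumulate at `0`; continuity of the functionals plays no role.
  have hD : Dense (⋃ l ∈ S, {s : ℝ | l Q + s * l (expMul t) = 0})ᶜ := by
    refine (hS.biUnion fun l hl => ?_).dense_compl ℝ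
    refine (countable_singleton (-l Q / l (expMul t))).mono fun s hs => ?_
    rw [mem_singleton_iff, eq_div_iff (ht l hl)]
    have hs : l Q + s * l (expMul t) = 0 := hs
    linear_combination hs
  have hc : Continuous fun s : ℝ => Q + s • expMul t := by fun_prop
  have hmem := mem_closure_image hc.continuousAt (hD 0)
  rw [zero_smul, add_zero] at hmem
  refine closure_mono ?_ hmem
  rintro _ ⟨s, hs, rfl⟩ l hl h0
  refine hs (mem_biUnion hl ?_)
  rw [map_add, map_smul, smul_eq_mul] at h0
  exact h0

end SmoothIcc

/-! ### Genericity and conclusion -/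

namespace IsDirichletSystem
variable {V : SmoothIcc} {c : ℝ} {w : ℕ+ → ℝ} {g g₁ : ℕ+ → ℝ → ℝ} {ρ : ℕ+ → ℝ}

/-- The nondegeneracy conditions of `exists_le_abs_integral` hold on a dense set. -/
theorem dense_nondegenerate {W : ℝ → ℝ} (H : IsDirichletSystem W w g g₁ ρ) :
    Dense {Q : SmoothIcc | (∀ p, |ρ p * derivIcc Q 1| ≠ |derivIcc Q 0|) ∧
      |derivIcc Q 1| ≠ |derivIcc Q 0| ∧
      (∀ p j, ∫ x in (0 : ℝ)..1, Q x * (g p x * g j x) ≠ 0) ∧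
      ∀ m : ℕ, ∫ x in (0 : ℝ)..1, Q x * Real.cos (m * Real.pi * x) ≠ 0} := by
  have hg : ∀ p j, ContinuousOn (fun x => g p x * g j x) (Icc 0 1) := fun p j =>
    (H.deriv p).continuousOn.mul (H.deriv j).continuousOn
  have hcos : ∀ m : ℕ, ContinuousOn (fun x => Real.cos (m * Real.pi * x)) (Icc 0 1) := fun m => by
    fun_prop
  let B : ℝ → ℝ → SmoothIcc →ₗ[ℝ] ℝ := fun a b =>
    a • SmoothIcc.derivFunctional 1 + b • SmoothIcc.derivFunctional 0
  have hB : ∀ a b Q, B a b Q = a * derivIcc Q 1 + b * derivIcc Q 0 := fun a b Q => by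
    simp only [B, LinearMap.add_apply, LinearMap.smul_apply, smul_eq_mul,
      SmoothIcc.derivFunctional_apply _ (left_mem_Icc.2 (zero_le_one' ℝ)),
      SmoothIcc.derivFunctional_apply _ (right_mem_Icc.2 (zero_le_one' ℝ))]
  -- An inequality `|x| ≠ |y|` is the pair of linear conditions `x + y ≠ 0` and `x - y ≠ 0`, hence
  -- the coefficients `1` and `-1` in `B`.
  let S : Set (SmoothIcc →ₗ[ℝ] ℝ) :=
    range (fun p => B (ρ p) 1) ∪ range (fun p => B (ρ p) (-1)) ∪ {B 1 1, B 1 (-1)} ∪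
    range (fun i : ℕ+ × ℕ+ => SmoothIcc.integralFunctional _ (hg i.1 i.2)) ∪
    range (fun m => SmoothIcc.integralFunctional _ (hcos m))
  have hS : S.Countable := by
    refine ((((countable_range _).union (countable_range _)).union ?_).union
      (countable_range _)).union (countable_range _)
    exact (Set.toFinite _).countable
  refine (SmoothIcc.dense_forall_ne_zero hS ?_).mono ?_
  · rintro l ((((⟨p, rfl⟩ | ⟨p, rfl⟩) | (rfl | rfl)) | ⟨i, rfl⟩) | ⟨m, rfl⟩)
    · exact SmoothIcc.countable_derivFunctional_expMul (Or.inr one_ne_zero)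
    · exact SmoothIcc.countable_derivFunctional_expMul (Or.inr (by norm_num))
    · exact SmoothIcc.countable_derivFunctional_expMul (Or.inr one_ne_zero)
    · exact SmoothIcc.countable_derivFunctional_expMul (Or.inr (by norm_num))
    · obtain ⟨x, hx, hne⟩ := H.exists_mul_ne_zero i.1 i.2
      exact SmoothIcc.countable_integralFunctional_expMul _ (Ioo_subset_Icc_self hx) hne
    · exact SmoothIcc.countable_integralFunctional_expMul _ (left_mem_Icc.2 zero_le_one) (by simp)
  · intro Q hQ
    have abs_ne : ∀ a, B a 1 Q ≠ 0 → B a (-1) Q ≠ 0 → |a * derivIcc Q 1| ≠ |derivIcc Q 0| := by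
      intro a h₁ h₂ h
      rw [hB] at h₁ h₂
      rcases abs_eq_abs.1 h with h | h
      · exact h₂ (by linarith)
      · exact h₁ (by linarith)
    refine ⟨fun p => abs_ne _ (hQ _ ?_) (hQ _ ?_), ?_,
      fun p j => hQ (SmoothIcc.integralFunctional _ (hg p j)) ?_,
      fun m => hQ (SmoothIcc.integralFunctional _ (hcos m)) ?_⟩
    · exact Or.inl (Or.inl (Or.inl (Or.inl ⟨p, rfl⟩)))
    · exact Or.inl (Or.inl (Or.inl (Or.inr ⟨p, rfl⟩)))
    · rw [← one_mul (derivIcc Q 1)]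
      refine abs_ne 1 (hQ _ ?_) (hQ _ ?_)
      · exact Or.inl (Or.inl (Or.inr (Or.inl rfl)))
      · exact Or.inl (Or.inl (Or.inr (Or.inr rfl)))
    · exact Or.inl (Or.inr ⟨(p, j), rfl⟩)
    · exact Or.inr ⟨m, rfl⟩

theorem exists_integral_sq_le {W : ℝ → ℝ} (H : IsDirichletSystem W w g g₁ ρ) :
    ∃ N, 0 < N ∧ ∀ n, ∫ x in (0 : ℝ)..1, g n x ^ 2 ≤ N := by
  obtain ⟨C, hC0, hC⟩ := H.exists_abs_integral_le (F := fun _ => 1) continuousOn_const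
  refine ⟨C + 1, by positivity, fun n => ?_⟩
  have := (le_abs_self _).trans (hC n n)
  simp only [one_mul, ← pow_two] at this
  linarith

theorem iInf_pos (H : IsDirichletSystem (fun x => V x + c) w g g₁ ρ) {lam : ℕ+ → ℝ}
    {e : ℕ+ → ℝ → ℂ} (he : IsEigensystem V lam e) {Q : ℝ → ℝ} {d : ℝ} (hd : 0 < d)
    (hQ : ∀ p j : ℕ+,
      d ≤ (p : ℝ) ^ 3 * (j : ℝ) ^ 3 * |∫ x in (0 : ℝ)..1, Q x * (g p x * g j x)|) :
    0 < ⨅ i : ℕ+ × ℕ+, ‖((i.1 : ℕ) : ℂ) ^ 3 * ((i.2 : ℕ) : ℂ) ^ 3 *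
      innerL2 (fun x => (Q x : ℂ) * e i.1 x) (e i.2)‖ := by
  obtain ⟨N, hN0, hN⟩ := H.exists_integral_sq_le
  refine (div_pos hd hN0).trans_le (le_ciInf fun i => ?_)
  obtain ⟨p, j⟩ := i
  have h := H.norm_innerL2 he Q p j
  rw [norm_mul, norm_mul, norm_pow, norm_pow, Complex.norm_natCast, Complex.norm_natCast]
  simp only
  set I := ‖innerL2 (fun x => (Q x : ℂ) * e p x) (e j)‖
  have hI0 : 0 ≤ I := norm_nonneg _
  have hle : |∫ x in (0 : ℝ)..1, Q x * (g p x * g j x)| ≤ I * N := by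
    refine abs_le_of_sq_le_sq ?_ (by positivity)
    rw [← h, mul_pow, pow_two N]
    have := (H.integral_sq_pos p).le
    have := (H.integral_sq_pos j).le
    gcongr
    · exact hN p
    · exact hN j
  rw [div_le_iff₀ hN0]
  calc d ≤ _ := hQ p j
    _ ≤ (p : ℝ) ^ 3 * (j : ℝ) ^ 3 * (I * N) := by gcongr
    _ = _ := by ring

end IsDirichletSystem

theorem lemma5p1 (V : SmoothIcc) :
    (∃ (lam : ℕ+ → ℝ) (e : ℕ+ → ℝ → ℂ), IsEigensystem V lam e) ∧
    ∀ (lam : ℕ+ → ℝ) (e : ℕ+ → ℝ → ℂ), IsEigensystem V lam e →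
      Dense {Q : SmoothIcc |
        0 < ⨅ i : ℕ+ × ℕ+,
          ‖((i.1 : ℕ) : ℂ) ^ 3 * ((i.2 : ℕ) : ℂ) ^ 3 *
            innerL2 (fun x => (Q x : ℂ) * e i.1 x) (e i.2)‖} := by
  -- Shifting by a bound for `|V|` makes the potential nonnegative; eigenfunctions are unchanged.
  obtain ⟨c, hc⟩ := isCompact_Icc.exists_bound_of_continuousOn V.continuousOn
  have hW : ContDiffOn ℝ ∞ (fun x => V x + c) (Icc 0 1) := V.contDiffOn.add contDiffOn_const
  have hW0 : ∀ x ∈ Icc (0 : ℝ) 1, 0 ≤ V x + c := fun x hx => by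
    linarith [neg_le_of_abs_le (hc x hx)]
  obtain ⟨w, g, g₁, ρ, H⟩ := exists_isDirichletSystem hW.continuousOn hW0
  refine ⟨⟨_, _, H.isEigensystem⟩, fun lam e he => H.dense_nondegenerate.mono ?_⟩
  rintro Q ⟨h₁, h₂, h₃, h₄⟩
  obtain ⟨d, hd, hQ⟩ := H.exists_le_abs_integral hW Q.contDiffOn h₁ h₂ h₃ h₄
  exact H.iInf_pos he hd hQ
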